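/- Let $\ell\ge 1$ and consider a single-server priority queueing system with $\ell$ infinite buffers, buffer $1$ having the highest priority. Customers of unit size arrive at the points $t_n=\tau_1+\dots+\tau_n$, $n\ge1$, of a renewal process $A(t)$, where $\tau_1,\tau_2,\dots$ are i.i.d. and almost surely positive, and $A(t)/t\to\lambda$ almost surely for a real number $\lambda$. Each arriving customer belongs to class $k$, i.e. joins buffer $k$, with probability $\pi^{(k)}>0$, $\sum_{k=1}^{\ell}\pi^{(k)}=1$, independently of the other customers and of the arrival times; $A^{(k)}(t)$ is the number of class-$k$ arrivals in $[0,t]$. Possible departures are governed by $\mathcal D(t)=C\,D(t)$, where $C\ge 1$ is an integer and $D$ is a Poisson process of rate $\mu>0$ independent of the arrival times and of the classes. The buffer contents $\mathcal Q^{(1)},\dots,\mathcal Q^{(\ell)}$ are integer-valued, right-continuous with left limits, start at zero, and almost surely satisfy, for all $t>0$ and $k=1,\dots,\ell$, $$\mathcal Q^{(k)}(t)=\max\Big\{0,\ \mathcal Q^{(k)}(t-)+\triangle A^{(k)}(t)-\big[\triangle\mathcal D(t)-\mathcal Q_{k-1}(t-)\big]\mathbf I\{\mathcal Q_{k-1}(t)=0\}\Big\},$$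 where $\mathcal Q_k=\mathcal Q^{(1)}+\dots+\mathcal Q^{(k)}$ is the $k$th cumulative buffer content, $\mathcal Q_0=0$, and $\triangle Z(t)=Z(t)-Z(t-)$. Assume the stability condition $\lambda/(\mu C)<1$. For $k=1,\dots,\ell$ let $t_{k,j}$ be the time of the $j$th arrival to one of the first $k$ buffers, let $B_k$ be the interarrival time distribution of the renewal process of these arrivals (the law of $t_{k,1}$), and let $\widehat B_k(s)=\int_0^\infty e^{-sx}\,\mathrm dB_k(x)$. Then, for every $k=1,\dots,\ell$, the equation $$z=\widehat B_k(\mu-\mu z^C)$$ has exactly one root $\varsigma_k$ in the interval $(0,1)$, and for every integer $m\ge 0$ $$P_{k,m}=\lim_{j\to\infty}\mathbb P\{\mathcal Q_k(t_{k,j}-)=m\}=\varsigma_k^m(1-\varsigma_k).$$ -/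

import Mathlib

open MeasureTheory ProbabilityTheory Filter Topology

/-- The `n`-th point (counting from `0`) of the point sequence whose successive spacings are
`τ 0, τ 1, …`: the points are `τ 0`, `τ 0 + τ 1`, `τ 0 + τ 1 + τ 2`, … -/
def epoch (τ : ℕ → ℝ) (n : ℕ) : ℝ := ∑ i ∈ Finset.range (n + 1), τ i

/-- The counting process of the points with spacings `τ`: the number of points in `[0, t]`. -/
noncomputable def pointCount (τ : ℕ → ℝ) (t : ℝ) : ℤ := ({n | epoch τ n ≤ t}.ncard : ℤ)

/-- The number of customers of class `k` that have arrived by time `t`, when the interarrival times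
are `τ` and the `n`-th customer has class `c n`. -/
noncomputable def classCount {ℓ : ℕ} (τ : ℕ → ℝ) (c : ℕ → Fin ℓ) (k : Fin ℓ) (t : ℝ) : ℤ :=
  ({n | epoch τ n ≤ t ∧ c n = k}.ncard : ℤ)

/-- The process of possible departures: it jumps by `C` at each point of the point sequence with
spacings `χ`. -/
noncomputable def departureProcess (C : ℕ) (χ : ℕ → ℝ) (t : ℝ) : ℤ := (C : ℤ) * pointCount χ t

/-- The jump `Z(t) - Z(t-)`. -/
noncomputable def jump (Z : ℝ → ℤ) (t : ℝ) : ℤ := Z t - Function.leftLim Z t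

/-- The content of buffer `k` together with all buffers of higher priority (lower number). -/
def cumulativeContent {ℓ : ℕ} (Q : Fin ℓ → ℝ → ℤ) (k : Fin ℓ) (t : ℝ) : ℤ :=
  ∑ i ∈ Finset.Iic k, Q i t

/-- The total content of the buffers of strictly higher priority than buffer `k`; it is `0` for the
buffer of highest priority. -/
def higherContent {ℓ : ℕ} (Q : Fin ℓ → ℝ → ℤ) (k : Fin ℓ) (t : ℝ) : ℤ :=
  ∑ i ∈ Finset.Iio k, Q i t

/-- `Q` is the path of the buffer contents of the infinite-buffer priority system with class arrival
processes `A` and possible-departure process `D`: each `Q k` starts at zero, is right-continuous with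
left limits on `[0, ∞)`, and for all `t > 0`
`Q k (t) = max {0, Q k (t-) + ΔA k (t) - [ΔD(t) - H(t-)] 𝟙{H(t) = 0}}`,
where `H` is the total content of the buffers of higher priority than `k`. For the first buffer
`H = 0`, and the equation reads `Q(t) = max {0, Q(t-) + ΔA(t) - ΔD(t)}`. -/
structure IsBufferContent {ℓ : ℕ} (A : Fin ℓ → ℝ → ℤ) (D : ℝ → ℤ) (Q : Fin ℓ → ℝ → ℤ) : Prop where
  start : ∀ k, Q k 0 = 0
  right_continuous : ∀ k, ∀ t : ℝ, 0 ≤ t → ContinuousWithinAt (Q k) (Set.Ici t) t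
  left_limits : ∀ k, ∀ t : ℝ, 0 < t → ∃ y : ℤ, Tendsto (Q k) (𝓝[<] t) (𝓝 y)
  equation : ∀ k, ∀ t : ℝ, 0 < t →
    Q k t = max 0 (Function.leftLim (Q k) t + jump (A k) t
      - (jump D t - Function.leftLim (higherContent Q k) t)
        * (if higherContent Q k t = 0 then 1 else 0))

/-- The time of the `j`-th (counting from `0`) arrival to one of the buffers `0, …, k`. -/
noncomputable def cumulativeEpoch {ℓ : ℕ} (τ : ℕ → ℝ) (c : ℕ → Fin ℓ) (k : Fin ℓ) (j : ℕ) : ℝ :=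
  epoch τ (Nat.nth (fun n => c n ≤ k) j)

/-- The interarrival time distribution of the arrivals to the buffers `0, …, k`: the law of the first
spacing of that renewal process, measured from time `0`. -/
noncomputable def interarrivalLaw {Ω : Type*} [MeasurableSpace Ω] (P : Measure Ω) {ℓ : ℕ}
    (τ : ℕ → Ω → ℝ) (c : ℕ → Ω → Fin ℓ) (k : Fin ℓ) : Measure ℝ :=
  P.map (fun ω => cumulativeEpoch (fun n => τ n ω) (fun n => c n ω) k 0)

/-- The Laplace–Stieltjes transform `∫₀^∞ e^{-sx} dB(x)`. -/
noncomputable def laplaceStieltjes (B : Measure ℝ) (s : ℝ) : ℝ :=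
  ∫ x in Set.Ici (0 : ℝ), Real.exp (-s * x) ∂B

/-!
Why the theorem holds.

*Pathwise reduction.* Almost surely no arrival coincides with a possible departure. At a departure
point the capacity `C` is used up by the buffers in the order of their priority, so the cumulative
content of the first `k` buffers behaves like the content of a single buffer that receives the
customers of the first `k` classes (`IsBufferContent.cumulativeContent_eq`). Hence its values `X j`
just before the successive arrivals satisfy `X 0 = 0` and `X (j + 1) = max 0 (X j + 1 - C N (j + 1))`,
where `N (j + 1)` is the number of points of the Poisson process between the arrivals `j` and `j + 1`
(`IsBufferContent.leftLim_cumulativeContent_eq_lindleyChain`).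

*The increments are independent.* All independence statements rest on one principle (`map_outputs`):
if a map sends a random state to an output and a new state such that the two are independent and the
new state has the law of the old one, then the successive outputs are i.i.d. Applied to the marked
arrival sequence stopped at the first customer of the first `k` classes (`map_blockStep`) it shows
that the thinned arrivals form a renewal process with spacing law `B`; applied to the pair of
this renewal process and the Poisson process (`map_countStep`, by memorylessness of the exponential
law) it shows that the `N j` are i.i.d. with the mixed Poisson law
`a r = ∫ exp (-μ x) (μ x) ^ r / r! dB(x)`, whose generating function at `z ^ C` is the transform of
`B` at `μ - μ z ^ C` (`hasSum_mixedPoissonLaw`).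

*The root.* The function `z ↦ B̂(μ - μ z ^ C)` is convex on `[0, 1]`, positive at `0`, equal to `1` at
`1`, and its slope at `1` is `μ C` times the mean of `B`, which exceeds `1` by stability and the
strong law of large numbers. So it meets the diagonal exactly once in `(0, 1)`
(`exists_unique_root`).

*The limit.* The tails `u j m = P (m ≤ X j)` satisfy `u (j + 1) (m + 1) = ∑ r, a r * u j (m + C r)`.
They increase with `j` and are bounded by `ς ^ m`, which solves the same equation without the
index `j`. The difference between `ς ^ m` and the limit is harmonic, vanishes at `0` and tends to zero
at infinity, so it is zero by the maximum principle (`tendsto_geometric_of_lindley`).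
-/

/-! ### Independent sequences -/

/-- The sequence with first term `x` followed by the terms of `s`. -/
def seqCons {S : Type*} (x : S) (s : ℕ → S) : ℕ → S
  | 0 => x
  | n + 1 => s n

/-- The sequence `s` without its first `n` terms. -/
def seqDrop {S : Type*} (n : ℕ) (s : ℕ → S) : ℕ → S := fun i => s (n + i)

lemma seqDrop_zero {S : Type*} (s : ℕ → S) : seqDrop 0 s = s := by
  funext i
  simp [seqDrop]

lemma seqCons_drop_one {S : Type*} (s : ℕ → S) : seqCons (s 0) (seqDrop 1 s) = s := by
  funext n
  cases n with
  | zero => rfl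
  | succ n => simp [seqCons, seqDrop, Nat.add_comm]

lemma seqDrop_succ_seqCons {S : Type*} (n : ℕ) (x : S) (s : ℕ → S) :
    seqDrop (n + 1) (seqCons x s) = seqDrop n s := by
  funext i
  have : n + 1 + i = (n + i) + 1 := by omega
  simp [seqDrop, this, seqCons]

lemma measurable_seqCons {S : Type*} [MeasurableSpace S] :
    Measurable (fun p : S × (ℕ → S) => seqCons p.1 p.2) := by
  refine measurable_pi_iff.2 fun n => ?_
  cases n with
  | zero => exact measurable_fst
  | succ n => exact (measurable_pi_apply n).comp measurable_snd

@[fun_prop]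
lemma measurable_seqDrop {S : Type*} [MeasurableSpace S] (n : ℕ) :
    Measurable (seqDrop n : (ℕ → S) → ℕ → S) :=
  measurable_pi_iff.2 fun i => measurable_pi_apply (n + i)

/-- The law of a sequence of independent random elements with common law `μ`. -/
noncomputable def iidLaw {S : Type*} [MeasurableSpace S] (μ : Measure S) : Measure (ℕ → S) :=
  Measure.infinitePi fun _ => μ

instance {S : Type*} [MeasurableSpace S] (μ : Measure S) [IsProbabilityMeasure μ] :
    IsProbabilityMeasure (iidLaw μ) := by
  unfold iidLaw; infer_instance

lemma set_pi_eq_pi_range {S : Type*} (s : Finset ℕ) (t : ℕ → Set S) :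
    Set.pi (s : Set ℕ) t
      = Set.pi (Finset.range (s.sup id + 1) : Set ℕ) (fun i => if i ∈ s then t i else Set.univ) := by
  ext f
  simp only [Set.mem_pi, Finset.mem_coe, Finset.mem_range]
  refine ⟨fun h i _ => ?_, fun h i hi => ?_⟩
  · split_ifs with hi
    · exact h i hi
    · trivial
  · have := h i (Nat.lt_succ_of_le (Finset.le_sup (f := id) hi))
    simpa [hi] using this

/-- A law on sequences is the law of independent elements with law `μ` as soon as it gives the
product mass to every box of initial coordinates. -/
lemma eq_iidLaw {S : Type*} [MeasurableSpace S] {μ : Measure S} [IsProbabilityMeasure μ]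
    {ν : Measure (ℕ → S)}
    (h : ∀ (n : ℕ) (t : ℕ → Set S), (∀ i, MeasurableSet (t i)) →
      ν {s | ∀ i < n, s i ∈ t i} = ∏ i ∈ Finset.range n, μ (t i)) :
    ν = iidLaw μ := by
  refine Measure.eq_infinitePi _ fun s t ht => ?_
  have h1 := h (s.sup id + 1) (fun i => if i ∈ s then t i else Set.univ) (fun i => by
    split_ifs
    exacts [ht i, MeasurableSet.univ])
  have h2 : Set.pi (s : Set ℕ) t = {f | ∀ i < s.sup id + 1,
      f i ∈ (fun i => if i ∈ s then t i else Set.univ) i} := by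
    rw [set_pi_eq_pi_range]
    ext f
    simp [Set.mem_pi]
  have hsub : s ⊆ Finset.range (s.sup id + 1) := fun i hi =>
    Finset.mem_range.2 (Nat.lt_succ_of_le (Finset.le_sup (f := id) hi))
  rw [h2, h1, ← Finset.prod_subset hsub]
  · exact Finset.prod_congr rfl fun i hi => by simp [hi]
  · intro i _ hi
    simp [hi]

lemma iidLaw_box {S : Type*} [MeasurableSpace S] {μ : Measure S} [IsProbabilityMeasure μ]
    (n : ℕ) {t : ℕ → Set S} (ht : ∀ i, MeasurableSet (t i)) :
    iidLaw μ {s | ∀ i < n, s i ∈ t i} = ∏ i ∈ Finset.range n, μ (t i) := by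
  have : {s : ℕ → S | ∀ i < n, s i ∈ t i} = Set.pi (Finset.range n : Set ℕ) t := by
    ext s; simp [Set.mem_pi]
  rw [this, iidLaw, Measure.infinitePi_pi _ (fun i _ => ht i)]

lemma map_seqCons {S : Type*} [MeasurableSpace S] (μ : Measure S) [IsProbabilityMeasure μ] :
    (μ.prod (iidLaw μ)).map (fun p => seqCons p.1 p.2) = iidLaw μ := by
  refine eq_iidLaw fun n t ht => ?_
  rw [Measure.map_apply measurable_seqCons (by
    have : {s : ℕ → S | ∀ i < n, s i ∈ t i} = Set.pi (Finset.range n : Set ℕ) t := by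
      ext s; simp [Set.mem_pi]
    rw [this]
    exact MeasurableSet.pi (Finset.countable_toSet _) fun i _ => ht i)]
  cases n with
  | zero => simp
  | succ n =>
    have : (fun p : S × (ℕ → S) => seqCons p.1 p.2) ⁻¹' {s | ∀ i < n + 1, s i ∈ t i}
        = t 0 ×ˢ {s | ∀ i < n, s i ∈ t (i + 1)} := by
      ext ⟨x, s⟩
      simp only [Set.mem_preimage, Set.mem_ofPred_eq, Set.mem_prod]
      refine ⟨fun h => ⟨h 0 (by omega), fun i hi => h (i + 1) (by omega)⟩, fun h i hi => ?_⟩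
      cases i with
      | zero => exact h.1
      | succ i => exact h.2 i (by omega)
    rw [this, Measure.prod_prod, iidLaw_box n (fun i => ht (i + 1)), Finset.prod_range_succ',
      mul_comm]

/-- The first term of an i.i.d. sequence is independent of the remaining terms, and these are again
an i.i.d. sequence with the same law. -/
lemma map_head_tail_iidLaw {S : Type*} [MeasurableSpace S] (μ : Measure S)
    [IsProbabilityMeasure μ] :
    (iidLaw μ).map (fun s => (s 0, seqDrop 1 s)) = μ.prod (iidLaw μ) := by
  have hm : Measurable (fun s : ℕ → S => (s 0, seqDrop 1 s)) :=
    (measurable_pi_apply 0).prodMk (measurable_seqDrop 1)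
  conv_lhs => rw [← map_seqCons μ]
  rw [Measure.map_map hm measurable_seqCons]
  have : (fun s : ℕ → S => (s 0, seqDrop 1 s)) ∘ (fun p : S × (ℕ → S) => seqCons p.1 p.2) = id := by
    funext p
    refine Prod.ext rfl ?_
    funext i
    simp [seqDrop, Nat.add_comm 1 i, seqCons]
  rw [this, Measure.map_id]

lemma lintegral_iidLaw_cons {S : Type*} [MeasurableSpace S] (μ : Measure S)
    [IsProbabilityMeasure μ] {f : (ℕ → S) → ENNReal} (hf : Measurable f) :
    ∫⁻ s, f s ∂iidLaw μ = ∫⁻ x, ∫⁻ s, f (seqCons x s) ∂iidLaw μ ∂μ := by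
  conv_lhs => rw [← map_seqCons μ]
  rw [lintegral_map hf measurable_seqCons, lintegral_prod (fun p : S × (ℕ → S) => f (seqCons p.1 p.2))
      (hf.comp measurable_seqCons).aemeasurable]

/-- An event determined by the first `n` terms of an i.i.d. sequence is independent of the
remaining terms, and these have the law of the whole sequence. -/
lemma iidLaw_inter_seqDrop {S : Type*} [MeasurableSpace S] (μ : Measure S)
    [IsProbabilityMeasure μ] (n : ℕ) {A R : Set (ℕ → S)} (hA : MeasurableSet A)
    (hR : MeasurableSet R) (hdep : ∀ s s' : ℕ → S, (∀ i < n, s i = s' i) → s ∈ A → s' ∈ A) :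
    iidLaw μ (A ∩ seqDrop n ⁻¹' R) = iidLaw μ A * iidLaw μ R := by
  induction n generalizing A with
  | zero =>
    rcases A.eq_empty_or_nonempty with rfl | ⟨a, ha⟩
    · simp
    · have : A = Set.univ := Set.eq_univ_of_forall fun s => hdep a s (by simp) ha
      have h0 : seqDrop 0 ⁻¹' R = R := by
        have : (seqDrop 0 : (ℕ → S) → ℕ → S) = id := funext seqDrop_zero
        rw [this, Set.preimage_id]
      simp [this, h0]
  | succ n ih =>
    have hc : ∀ x : S, Measurable (seqCons x) := fun x =>
      measurable_seqCons.comp (measurable_const.prodMk measurable_id)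
    have hsec : ∀ x, MeasurableSet (seqCons x ⁻¹' A) := fun x => hc x hA
    have key : ∀ B : Set (ℕ → S), MeasurableSet B →
        iidLaw μ B = ∫⁻ x, iidLaw μ (seqCons x ⁻¹' B) ∂μ := fun B hB => by
      conv_lhs => rw [← map_seqCons μ]
      rw [Measure.map_apply measurable_seqCons hB, Measure.prod_apply (measurable_seqCons hB)]
      rfl
    rw [key _ (hA.inter (measurable_seqDrop _ hR)), key A hA, ← lintegral_mul_const']
    · refine lintegral_congr fun x => ?_
      rw [← ih (hsec x)]
      · congr 1
        ext s
        simp [seqDrop_succ_seqCons]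
      · intro s s' hs h
        refine hdep _ _ (fun i hi => ?_) h
        cases i with
        | zero => rfl
        | succ i => exact hs i (by omega)
    · exact measure_ne_top _ _

/-- The successive outputs of the map `G`, which sends a state to an output and a new state. -/
def outputs {E S : Type*} (G : E → S × E) (e : E) (n : ℕ) : S :=
  (G ((fun e => (G e).2)^[n] e)).1

lemma outputs_zero {E S : Type*} (G : E → S × E) (e : E) : outputs G e 0 = (G e).1 := rfl

lemma outputs_succ {E S : Type*} (G : E → S × E) (e : E) (n : ℕ) :
    outputs G e (n + 1) = outputs G (G e).2 n := by
  simp [outputs, Function.iterate_succ_apply]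

lemma measurable_outputs {E S : Type*} [MeasurableSpace E] [MeasurableSpace S] {G : E → S × E}
    (hG : Measurable G) : Measurable (outputs G) :=
  measurable_pi_iff.2 fun n =>
    (measurable_fst.comp hG).comp ((measurable_snd.comp hG).iterate n)

/-- If the output and the new state are independent, the output with law `q` and the new state with
the law `m` of the old one, then the successive outputs are independent with law `q`. -/
lemma map_outputs {E S : Type*} [MeasurableSpace E] [MeasurableSpace S] {G : E → S × E}
    (hG : Measurable G) {m : Measure E} {q : Measure S} [IsProbabilityMeasure m]
    [IsProbabilityMeasure q] (h : m.map G = q.prod m) : m.map (outputs G) = iidLaw q := by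
  have hmeas : ∀ (n : ℕ) (t : ℕ → Set S), (∀ i, MeasurableSet (t i)) →
      MeasurableSet {s : ℕ → S | ∀ i < n, s i ∈ t i} := fun n t ht => by
    have : {s : ℕ → S | ∀ i < n, s i ∈ t i} = Set.pi (Finset.range n : Set ℕ) t := by
      ext s; simp [Set.mem_pi]
    rw [this]
    exact MeasurableSet.pi (Finset.countable_toSet _) fun i _ => ht i
  refine eq_iidLaw fun n => ?_
  induction n with
  | zero =>
    intro t ht
    rw [Measure.map_apply (measurable_outputs hG) (hmeas _ t ht)]
    simp
  | succ n ih =>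
    intro t ht
    have h2 := ih (fun i => t (i + 1)) (fun i => ht _)
    rw [Measure.map_apply (measurable_outputs hG) (hmeas _ _ fun i => ht _)] at h2 ⊢
    have : outputs G ⁻¹' {s | ∀ i < n + 1, s i ∈ t i}
        = G ⁻¹' (t 0 ×ˢ (outputs G ⁻¹' {s | ∀ i < n, s i ∈ t (i + 1)})) := by
      ext e
      simp only [Set.mem_preimage, Set.mem_ofPred_eq, Set.mem_prod]
      refine ⟨fun h => ⟨h 0 (by omega), fun i hi => ?_⟩, fun h i hi => ?_⟩
      · rw [← outputs_succ]; exact h (i + 1) (by omega)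
      · cases i with
        | zero => exact h.1
        | succ i => rw [outputs_succ]; exact h.2 i (by omega)
    rw [this, ← Measure.map_apply hG ((ht 0).prod (measurable_outputs hG
      (hmeas n _ fun i => ht (i + 1)))), h, Measure.prod_prod, h2, Finset.prod_range_succ', mul_comm]

lemma iIndepFun.map_eq_iidLaw {Ω S : Type*} [MeasurableSpace Ω] [MeasurableSpace S]
    {P : Measure Ω} {X : ℕ → Ω → S} (hX : ∀ n, Measurable (X n)) (hind : iIndepFun X P)
    {μ : Measure S} (hμ : ∀ n, P.map (X n) = μ) :
    P.map (fun ω n => X n ω) = iidLaw μ := by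
  rw [hind.map_fun_eq_infinitePi_map hX, iidLaw]
  simp_rw [hμ]

/-- Two independent i.i.d. sequences, zipped together, form an i.i.d. sequence of pairs. -/
lemma map_pairs_iidLaw {S T : Type*} [MeasurableSpace S] [MeasurableSpace T] (μ : Measure S)
    (ν : Measure T) [IsProbabilityMeasure μ] [IsProbabilityMeasure ν] :
    ((iidLaw μ).prod (iidLaw ν)).map (fun e n => (e.1 n, e.2 n)) = iidLaw (μ.prod ν) := by
  let G : (ℕ → S) × (ℕ → T) → (S × T) × ((ℕ → S) × (ℕ → T)) :=
    fun e => ((e.1 0, e.2 0), (seqDrop 1 e.1, seqDrop 1 e.2))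
  have hG : Measurable G := by fun_prop
  have hmap : ((iidLaw μ).prod (iidLaw ν)).map G
      = (μ.prod ν).prod ((iidLaw μ).prod (iidLaw ν)) := by
    let r : (S × (ℕ → S)) × (T × (ℕ → T)) → (S × T) × ((ℕ → S) × (ℕ → T)) :=
      fun e => ((e.1.1, e.2.1), (e.1.2, e.2.2))
    have hr : Measurable r := by fun_prop
    have h1 : Measurable (fun s : ℕ → S => (s 0, seqDrop 1 s)) := by fun_prop
    have h2 : Measurable (fun s : ℕ → T => (s 0, seqDrop 1 s)) := by fun_prop
    have : G = r ∘ Prod.map (fun s : ℕ → S => (s 0, seqDrop 1 s))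
        (fun s : ℕ → T => (s 0, seqDrop 1 s)) := rfl
    rw [this, ← Measure.map_map hr (h1.prodMap h2), ← Measure.map_prod_map _ _ h1 h2,
      map_head_tail_iidLaw, map_head_tail_iidLaw]
    refine Measure.ext_of_lintegral _ fun f hf => ?_
    rw [lintegral_map hf hr,
      lintegral_prod (fun e => f (r e)) (hf.comp hr).aemeasurable,
      lintegral_prod _ (by fun_prop), lintegral_prod _ (by fun_prop), lintegral_prod _ (by fun_prop)]
    refine lintegral_congr fun x => ?_
    have e1 : ∀ s : ℕ → S, ∫⁻ e : T × (ℕ → T), f (r ((x, s), e)) ∂ν.prod (iidLaw ν)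
        = ∫⁻ y, ∫⁻ t, f ((x, y), (s, t)) ∂iidLaw ν ∂ν := fun s =>
      lintegral_prod _ (by fun_prop)
    have e2 : ∀ y : T, ∫⁻ e : (ℕ → S) × (ℕ → T), f ((x, y), e) ∂(iidLaw μ).prod (iidLaw ν)
        = ∫⁻ s, ∫⁻ t, f ((x, y), (s, t)) ∂iidLaw ν ∂iidLaw μ := fun y =>
      lintegral_prod _ (by fun_prop)
    simp only [e1, e2]
    exact lintegral_lintegral_swap (by fun_prop)
  have hout : (fun (e : (ℕ → S) × (ℕ → T)) n => (e.1 n, e.2 n)) = outputs G := by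
    funext e n
    induction n generalizing e with
    | zero => rfl
    | succ n ih =>
      rw [outputs_succ, ← ih]
      simp [G, seqDrop, Nat.add_comm]
  rw [hout, map_outputs hG hmap]

/-- In an i.i.d. sequence an event of positive probability occurs infinitely often. -/
lemma ae_frequently_mem {Ω S : Type*} [MeasurableSpace Ω] [MeasurableSpace S] {P : Measure Ω}
    [IsProbabilityMeasure P] {X : ℕ → Ω → S} (hX : ∀ n, Measurable (X n)) (hind : iIndepFun X P)
    {μ : Measure S} (hμ : ∀ n, P.map (X n) = μ) {A : Set S} (hA : MeasurableSet A)
    (hpos : μ A ≠ 0) : ∀ᵐ ω ∂P, ∃ᶠ n in atTop, X n ω ∈ A := by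
  have hs : ∀ n, MeasurableSet (X n ⁻¹' A) := fun n => hX n hA
  have hi : iIndepSet (fun n => X n ⁻¹' A) P := by
    rw [iIndepSet_iff_meas_biInter hs]
    intro s
    exact hind.measure_inter_preimage_eq_mul s (fun i _ => hA)
  have hm : ∀ n, P (X n ⁻¹' A) = μ A := fun n => by
    rw [← hμ n, Measure.map_apply (hX n) hA]
  have h1 := measure_limsup_eq_one hs hi (by simp [hm, ENNReal.tsum_const_eq_top_of_ne_zero hpos])
  have hlim : MeasurableSet (limsup (fun n => X n ⁻¹' A) atTop) := by
    exact MeasurableSet.measurableSet_limsup hs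
  have h2 : ∀ᵐ ω ∂P, ω ∈ limsup (fun n => X n ⁻¹' A) atTop :=
    (prob_compl_eq_zero_iff hlim).2 h1
  filter_upwards [h2] with ω hω
  simpa [Filter.mem_limsup_iff_frequently_mem] using hω

lemma nat_sInf_eq_iff {p : ℕ → Prop} (h : ∃ n, p n) (n : ℕ) :
    sInf {n | p n} = n ↔ (∀ m < n, ¬ p m) ∧ p n := by
  constructor
  · rintro rfl
    exact ⟨fun m hm => Nat.notMem_of_lt_sInf hm, Nat.sInf_mem (s := {n | p n}) h⟩
  · rintro ⟨h1, h2⟩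
    refine le_antisymm (Nat.sInf_le h2) (le_csInf h fun m hm => ?_)
    by_contra! hlt
    exact h1 m hlt hm

lemma measurable_nat_sInf {E : Type*} [MeasurableSpace E] {p : E → ℕ → Prop}
    (hp : ∀ n, MeasurableSet {e | p e n}) : Measurable (fun e => sInf {n | p e n}) := by
  have hE : MeasurableSet {e | ∃ n, p e n} := by
    rw [Set.ofPred_exists]
    exact MeasurableSet.iUnion hp
  refine measurable_to_countable' fun n => ?_
  have hn : MeasurableSet {e | (∀ m < n, ¬ p e m) ∧ p e n} := by
    have : {e | (∀ m < n, ¬ p e m) ∧ p e n} = (⋂ m : ℕ, ⋂ _ : m < n, {e | p e m}ᶜ) ∩ {e | p e n} := by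
      ext e; simp
    rw [this]
    exact (MeasurableSet.iInter fun m => MeasurableSet.iInter fun _ => (hp m).compl).inter (hp n)
  have hset : (fun e => sInf {n | p e n}) ⁻¹' {n}
      = ({e | ∃ n, p e n} ∩ {e | (∀ m < n, ¬ p e m) ∧ p e n})
        ∪ ({e | ∃ n, p e n}ᶜ ∩ {_e | n = 0}) := by
    ext e
    by_cases h : ∃ n, p e n
    · simp only [Set.mem_preimage, Set.mem_singleton_iff, nat_sInf_eq_iff h, Set.mem_union,
        Set.mem_inter_iff, Set.mem_ofPred_eq, Set.mem_compl_iff, h]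
      simp
    · have : {n | p e n} = ∅ := Set.eq_empty_of_forall_notMem fun n hn => h ⟨n, hn⟩
      simp only [Set.mem_preimage, Set.mem_singleton_iff, this, Nat.sInf_empty, Set.mem_union,
        Set.mem_inter_iff, Set.mem_ofPred_eq, Set.mem_compl_iff, h]
      simp [eq_comm]
  rw [hset]
  exact (hE.inter hn).union (hE.compl.inter (MeasurableSet.const _))

/-! ### Counting the points of a Poisson process -/

lemma epoch_seqCons_zero (x : ℝ) (s : ℕ → ℝ) : epoch (seqCons x s) 0 = x := by
  simp [epoch, seqCons]

lemma epoch_seqCons_succ (x : ℝ) (s : ℕ → ℝ) (n : ℕ) :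
    epoch (seqCons x s) (n + 1) = x + epoch s n := by
  rw [epoch, Finset.sum_range_succ', add_comm]
  rfl

lemma epoch_succ (s : ℕ → ℝ) (n : ℕ) : epoch s (n + 1) = epoch s n + s (n + 1) :=
  Finset.sum_range_succ _ _

lemma epoch_succ_eq_add_drop (s : ℕ → ℝ) (n : ℕ) :
    epoch s (n + 1) = s 0 + epoch (seqDrop 1 s) n := by
  conv_lhs => rw [← seqCons_drop_one s]
  exact epoch_seqCons_succ _ _ _

@[fun_prop]
lemma measurable_epoch (n : ℕ) : Measurable (fun s : ℕ → ℝ => epoch s n) := by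
  unfold epoch
  fun_prop

lemma epoch_pos {s : ℕ → ℝ} (hs : ∀ n, 0 < s n) (n : ℕ) : 0 < epoch s n :=
  Finset.sum_pos (fun i _ => hs i) Finset.nonempty_range_add_one

lemma strictMono_epoch {s : ℕ → ℝ} (hs : ∀ n, 0 < s n) : StrictMono (epoch s) :=
  strictMono_nat_of_lt_succ fun n => by rw [epoch_succ]; linarith [hs (n + 1)]

/-- Points whose positive spacings do not tend to zero leave every bounded interval. -/
lemma tendsto_epoch_atTop {s : ℕ → ℝ} (hs : ∀ n, 0 < s n) {ε : ℝ} (hε : 0 < ε)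
    (hf : ∃ᶠ n in atTop, ε < s n) : Tendsto (epoch s) atTop atTop := by
  have hmono := (strictMono_epoch hs).monotone
  have key : ∀ N : ℕ, ∃ n, N * ε < epoch s n := by
    intro N
    induction N with
    | zero => exact ⟨0, by simpa [epoch] using hs 0⟩
    | succ N ih =>
      obtain ⟨n, hn⟩ := ih
      obtain ⟨m, hm, hm'⟩ := frequently_atTop.1 hf (n + 1)
      obtain ⟨j, rfl⟩ : ∃ j, m = j + 1 := ⟨m - 1, by omega⟩
      refine ⟨j + 1, ?_⟩
      rw [epoch_succ]
      have := hmono (show n ≤ j by omega)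
      push_cast
      linarith
  refine tendsto_atTop_atTop_of_monotone hmono fun b => ?_
  obtain ⟨N, hN⟩ := exists_nat_ge (b / ε)
  obtain ⟨n, hn⟩ := key N
  exact ⟨n, ((div_le_iff₀ hε).1 hN).trans hn.le⟩

/-- Points whose spacings are independent, positive and identically distributed leave every bounded
interval. -/
lemma ae_tendsto_epoch {Ω : Type*} [MeasurableSpace Ω] {P : Measure Ω} [IsProbabilityMeasure P]
    {X : ℕ → Ω → ℝ} (hX : ∀ n, Measurable (X n)) (hind : iIndepFun X P) {μ : Measure ℝ}
    (hμ : ∀ n, P.map (X n) = μ) (hpos : ∀ n, ∀ᵐ ω ∂P, 0 < X n ω) :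
    ∀ᵐ ω ∂P, Tendsto (epoch fun n => X n ω) atTop atTop := by
  -- positive spacings exceed some positive level with positive probability, hence infinitely often
  obtain ⟨i, hi⟩ : ∃ i : ℕ, μ (Set.Ioi (1 / ((i : ℝ) + 1))) ≠ 0 := by
    by_contra! h
    have h0 : μ (Set.Ioi 0) = 0 := by
      have : Set.Ioi (0 : ℝ) = ⋃ i : ℕ, Set.Ioi (1 / ((i : ℝ) + 1)) := by
        ext x
        simp only [Set.mem_Ioi, Set.mem_iUnion]
        exact ⟨fun hx => exists_nat_one_div_lt hx, fun ⟨i, hi⟩ => lt_trans (by positivity) hi⟩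
      rw [this]
      exact measure_iUnion_null h
    rw [← hμ 0, Measure.map_apply (hX 0) measurableSet_Ioi] at h0
    have h1 : P (X 0 ⁻¹' Set.Ioi 0) = 1 := by
      rw [← measure_univ (μ := P)]
      refine measure_congr ?_
      filter_upwards [hpos 0] with ω hω
      exact propext (iff_of_true hω trivial)
    simp [h1] at h0
  filter_upwards [ae_frequently_mem hX hind hμ measurableSet_Ioi hi, ae_all_iff.2 hpos] with ω h1 h2
  exact tendsto_epoch_atTop h2 (by positivity) h1

/-- The number of points in `[0, x]`, for points with spacings `χ` that leave every bounded
interval. -/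
noncomputable def countTo (x : ℝ) (χ : ℕ → ℝ) : ℕ := sInf {n | x < epoch χ n}

/-- The spacings of the points after `x`, measured from `x`. -/
noncomputable def residualSpacings (x : ℝ) (χ : ℕ → ℝ) : ℕ → ℝ :=
  seqCons (epoch χ (countTo x χ) - x) (seqDrop (countTo x χ + 1) χ)

lemma countTo_eq_iff {x : ℝ} {χ : ℕ → ℝ} (h : ∃ n, x < epoch χ n) (n : ℕ) :
    countTo x χ = n ↔ (∀ m < n, epoch χ m ≤ x) ∧ x < epoch χ n := by
  have := nat_sInf_eq_iff h n
  simp only [not_lt] at this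
  exact this

lemma measurable_countTo : Measurable (fun p : ℝ × (ℕ → ℝ) => countTo p.1 p.2) :=
  measurable_nat_sInf (p := fun (p : ℝ × (ℕ → ℝ)) n => p.1 < epoch p.2 n) fun m =>
    measurableSet_lt measurable_fst ((measurable_epoch m).comp measurable_snd)

lemma measurable_residualSpacings : Measurable (fun p : ℝ × (ℕ → ℝ) => residualSpacings p.1 p.2) := by
  have h : Measurable (fun q : ℕ × (ℝ × (ℕ → ℝ)) =>
      seqCons (epoch q.2.2 q.1 - q.2.1) (seqDrop (q.1 + 1) q.2.2)) := by
    refine measurable_from_prod_countable_right fun n => ?_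
    exact measurable_seqCons.comp ((((measurable_epoch n).comp measurable_snd).sub
      measurable_fst).prodMk ((measurable_seqDrop (n + 1)).comp measurable_snd))
  exact h.comp (measurable_countTo.prodMk measurable_id)

/-- The weights of the Poisson distribution with parameter `x`. -/
noncomputable def poissonWeight (x : ℝ) (n : ℕ) : ℝ := Real.exp (-x) * x ^ n / n.factorial

lemma poissonWeight_nonneg {x : ℝ} (hx : 0 ≤ x) (n : ℕ) : 0 ≤ poissonWeight x n := by
  unfold poissonWeight; positivity

@[fun_prop]
lemma continuous_poissonWeight (n : ℕ) : Continuous (fun x => poissonWeight x n) := by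
  unfold poissonWeight; fun_prop

lemma lintegral_expMeasure (mu : ℝ) {g : ℝ → ENNReal} (hg : Measurable g) :
    ∫⁻ y, g y ∂expMeasure mu = ∫⁻ y, exponentialPDF mu y * g y := by
  have hm : Measurable (exponentialPDF mu) :=
    (measurable_exponentialPDFReal mu).ennreal_ofReal
  have : expMeasure mu = volume.withDensity (exponentialPDF mu) := rfl
  rw [this, lintegral_withDensity_eq_lintegral_mul _ hm hg]
  rfl

/-- The exponential distribution is memoryless. -/
lemma lintegral_expMeasure_memoryless (mu : ℝ) {x : ℝ} (hx : 0 ≤ x) {g : ℝ → ENNReal}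
    (hg : Measurable g) :
    ∫⁻ y, (Set.Ioi x).indicator (fun y => g (y - x)) y ∂expMeasure mu
      = ENNReal.ofReal (Real.exp (-(mu * x))) * ∫⁻ y, g y ∂expMeasure mu := by
  have hm : Measurable (exponentialPDF mu) :=
    (measurable_exponentialPDFReal mu).ennreal_ofReal
  rw [lintegral_expMeasure mu hg, lintegral_expMeasure mu
    (g := (Set.Ioi x).indicator fun y => g (y - x))
    ((hg.comp (measurable_id.sub_const x)).indicator measurableSet_Ioi),
    ← lintegral_sub_right_eq_self (fun y => exponentialPDF mu y * g y) x,
    ← lintegral_const_mul' _ _ ENNReal.ofReal_ne_top]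
  refine lintegral_congr_ae ?_
  have hne : ∀ᵐ y : ℝ, y ≠ x := by simp [ae_iff]
  filter_upwards [hne] with y hy
  rcases lt_or_gt_of_ne hy with h | h
  · rw [Set.indicator_of_notMem (by simpa using h.le), exponentialPDF_of_neg (x := y - x) (by linarith)]
    simp
  · rw [Set.indicator_of_mem (by simpa using h), exponentialPDF_of_nonneg (by linarith),
      exponentialPDF_of_nonneg (by linarith), ← mul_assoc,
      ← ENNReal.ofReal_mul (Real.exp_pos _).le]
    congr 2
    rw [show -(mu * y) = -(mu * x) + -(mu * (y - x)) by ring, Real.exp_add]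
    ring

lemma lintegral_expMeasure_poissonWeight {mu : ℝ} (hmu : 0 < mu) {x : ℝ} (hx : 0 ≤ x) (n : ℕ) :
    ∫⁻ y, (Set.Iic x).indicator (fun y => ENNReal.ofReal (poissonWeight (mu * (x - y)) n)) y
      ∂expMeasure mu = ENNReal.ofReal (poissonWeight (mu * x) (n + 1)) := by
  rw [lintegral_expMeasure mu (Measurable.indicator (by fun_prop) measurableSet_Iic)]
  let f : ℝ → ℝ := fun y => mu * Real.exp (-(mu * x)) * (mu * (x - y)) ^ n / n.factorial
  have h1 : ∀ y, exponentialPDF mu y * (Set.Iic x).indicator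
      (fun y => ENNReal.ofReal (poissonWeight (mu * (x - y)) n)) y
      = (Set.Icc 0 x).indicator (fun y => ENNReal.ofReal (f y)) y := by
    intro y
    by_cases hy : y ∈ Set.Icc 0 x
    · rw [Set.indicator_of_mem hy, Set.indicator_of_mem (by simpa using hy.2),
        exponentialPDF_of_nonneg hy.1, ← ENNReal.ofReal_mul (by positivity)]
      congr 1
      simp only [f, poissonWeight]
      rw [show -(mu * x) = -(mu * y) + -(mu * (x - y)) by ring, Real.exp_add]
      ring
    · rw [Set.indicator_of_notMem hy]
      rcases lt_or_ge y 0 with h | h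
      · rw [exponentialPDF_of_neg h, zero_mul]
      · rw [Set.indicator_of_notMem, mul_zero]
        simp only [Set.mem_Iic, not_le]
        by_contra! h'
        exact hy ⟨h, h'⟩
  simp_rw [h1]
  rw [lintegral_indicator measurableSet_Icc]
  have hcont : Continuous f := by fun_prop
  rw [← ofReal_integral_eq_lintegral_ofReal (hcont.integrableOn_Icc)
    ((ae_restrict_iff' measurableSet_Icc).2 (ae_of_all _ fun y hy => by
      have : 0 ≤ x - y := by linarith [hy.2]
      simp only [f, Pi.zero_apply]; positivity))]
  congr 1
  rw [integral_Icc_eq_integral_Ioc, ← intervalIntegral.integral_of_le hx]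
  have hd : ∀ y ∈ Set.uIcc 0 x, HasDerivAt
      (fun y => -(Real.exp (-(mu * x)) * (mu * (x - y)) ^ (n + 1) / (n + 1).factorial)) (f y) y := by
    intro y _
    have h2 : HasDerivAt (fun y => mu * (x - y)) (-mu) y := by
      simpa using ((hasDerivAt_id y).const_sub x).const_mul mu
    have h3 := (((h2.pow (n + 1)).const_mul (Real.exp (-(mu * x)))).div_const
      ((n + 1).factorial : ℝ)).neg
    convert! h3 using 1
    simp only [f, Nat.factorial_succ]
    push_cast
    have : (n.factorial : ℝ) ≠ 0 := by positivity
    have : (n : ℝ) + 1 ≠ 0 := by positivity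
    field_simp
  rw [intervalIntegral.integral_eq_sub_of_hasDerivAt hd (hcont.intervalIntegrable _ _)]
  simp [poissonWeight]

/-- The event that exactly `n` points lie in `[0, x]` and that the spacings of the points after `x`
belong to `R`. The proof conditions on the first spacing `y`: if it exceeds `x`, memorylessness
applies, and otherwise the remaining points are a Poisson process observed on `[0, x - y]`. -/
lemma iidLaw_exp_points {mu : ℝ} (hmu : 0 < mu) [IsProbabilityMeasure (expMeasure mu)]
    {R : Set (ℕ → ℝ)} (hR : MeasurableSet R) (n : ℕ) {x : ℝ} (hx : 0 ≤ x) :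
    iidLaw (expMeasure mu) {χ | (∀ m < n, epoch χ m ≤ x) ∧ x < epoch χ n ∧
        seqCons (epoch χ n - x) (seqDrop (n + 1) χ) ∈ R}
      = ENNReal.ofReal (poissonWeight (mu * x) n) * iidLaw (expMeasure mu) R := by
  have hmeas : ∀ n x, MeasurableSet {χ : ℕ → ℝ | (∀ m < n, epoch χ m ≤ x) ∧ x < epoch χ n ∧
        seqCons (epoch χ n - x) (seqDrop (n + 1) χ) ∈ R} := by
    intro n x
    refine MeasurableSet.inter ?_ (MeasurableSet.inter ?_ ?_)
    · have : {χ : ℕ → ℝ | ∀ m < n, epoch χ m ≤ x}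
          = ⋂ m : ℕ, ⋂ _ : m < n, {χ : ℕ → ℝ | epoch χ m ≤ x} := by
        ext p; simp
      have h2 : MeasurableSet {χ : ℕ → ℝ | ∀ m < n, epoch χ m ≤ x} := by
        rw [this]
        exact MeasurableSet.iInter fun m => MeasurableSet.iInter fun _ =>
          measurableSet_le (measurable_epoch m) measurable_const
      exact h2
    · exact measurableSet_lt measurable_const (measurable_epoch n)
    · exact (measurable_seqCons.comp (((measurable_epoch n).sub_const x).prodMk
        (measurable_seqDrop (n + 1)))) hR
  have key : ∀ B : Set (ℕ → ℝ), MeasurableSet B → iidLaw (expMeasure mu) B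
      = ∫⁻ y, iidLaw (expMeasure mu) (seqCons y ⁻¹' B) ∂expMeasure mu := fun B hB => by
    conv_lhs => rw [← map_seqCons (expMeasure mu)]
    rw [Measure.map_apply measurable_seqCons hB, Measure.prod_apply (measurable_seqCons hB)]
    rfl
  have hg : Measurable fun y => iidLaw (expMeasure mu) (seqCons y ⁻¹' R) :=
    measurable_measure_prodMk_left (measurable_seqCons hR)
  induction n generalizing x with
  | zero =>
    rw [key _ (hmeas 0 x), key R hR]
    have : ENNReal.ofReal (poissonWeight (mu * x) 0) = ENNReal.ofReal (Real.exp (-(mu * x))) := by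
      simp [poissonWeight]
    rw [this, ← lintegral_expMeasure_memoryless mu hx hg]
    refine lintegral_congr fun y => ?_
    by_cases hy : x < y
    · rw [Set.indicator_of_mem (by simpa using hy)]
      congr 1
      ext χ
      simp [epoch_seqCons_zero, seqDrop_succ_seqCons, seqDrop_zero, hy]
    · rw [Set.indicator_of_notMem (by simpa using hy)]
      simp [epoch_seqCons_zero, hy]
  | succ n ih =>
    rw [key _ (hmeas (n + 1) x), ← lintegral_expMeasure_poissonWeight hmu hx n,
      ← lintegral_mul_const' _ _ (measure_ne_top _ _)]
    refine lintegral_congr fun y => ?_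
    by_cases hy : y ≤ x
    · rw [Set.indicator_of_mem (by simpa using hy), ← ih (sub_nonneg.2 hy)]
      congr 1
      ext χ
      simp only [Set.mem_preimage, Set.mem_ofPred_eq, epoch_seqCons_succ, seqDrop_succ_seqCons]
      rw [show y + epoch χ n - x = epoch χ n - (x - y) by ring, sub_lt_iff_lt_add']
      refine and_congr_left fun _ => ⟨fun h m hm => ?_, fun h m hm => ?_⟩
      · have := h (m + 1) (by omega)
        rw [epoch_seqCons_succ] at this
        linarith
      · cases m with
        | zero => rwa [epoch_seqCons_zero]
        | succ m =>
          rw [epoch_seqCons_succ]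
          linarith [h m (by omega)]
    · rw [Set.indicator_of_notMem (by simpa using hy), zero_mul]
      have : seqCons y ⁻¹' {χ : ℕ → ℝ | (∀ m < n + 1, epoch χ m ≤ x) ∧ x < epoch χ (n + 1) ∧
          seqCons (epoch χ (n + 1) - x) (seqDrop (n + 1 + 1) χ) ∈ R} = ∅ := by
        refine Set.eq_empty_of_forall_notMem fun χ hχ => hy ?_
        simpa [epoch_seqCons_zero] using hχ.1 0 (by omega)
      rw [this, measure_empty]

lemma expMeasure_Iic_zero {mu : ℝ} (hmu : 0 < mu) : expMeasure mu (Set.Iic 0) = 0 := by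
  have : expMeasure mu = volume.withDensity (exponentialPDF mu) := rfl
  rw [this, withDensity_apply _ measurableSet_Iic, lintegral_exponentialPDF_eq_antiDeriv hmu]
  simp

lemma ae_pos_of_measure_Iic_zero {B : Measure ℝ} (hB : B (Set.Iic 0) = 0) : ∀ᵐ x ∂B, 0 < x := by
  rw [ae_iff]
  convert hB using 2
  ext x; simp

lemma ae_iidLaw_pos {B : Measure ℝ} [IsProbabilityMeasure B] (hB : B (Set.Iic 0) = 0) :
    ∀ᵐ s ∂iidLaw B, ∀ n, 0 < s n := by
  refine ae_all_iff.2 fun n => ?_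
  have h : (iidLaw B).map (fun s => s n) = B := Measure.infinitePi_map_eval _ n
  have h2 := ae_pos_of_measure_Iic_zero hB
  rw [← h] at h2
  exact ae_of_ae_map (measurable_pi_apply n).aemeasurable h2

lemma ae_iidLaw_tendsto_epoch {B : Measure ℝ} [IsProbabilityMeasure B] (hB : B (Set.Iic 0) = 0) :
    ∀ᵐ s ∂iidLaw B, Tendsto (epoch s) atTop atTop := by
  have hi : iIndepFun (fun n (s : ℕ → ℝ) => s n) (iidLaw B) :=
    iIndepFun_infinitePi (P := fun _ : ℕ => B) (X := fun _ x => x) (fun _ => measurable_id)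
  exact ae_tendsto_epoch (fun n => measurable_pi_apply n) hi
    (fun n => Measure.infinitePi_map_eval (fun _ : ℕ => B) n) (ae_all_iff.1 (ae_iidLaw_pos hB))

/-- For a Poisson process the number of points in `[0, x]` and the points after `x` are independent,
the number has a Poisson distribution and the points after `x` form again a Poisson process. -/
lemma iidLaw_exp_countTo_residualSpacings {mu : ℝ} (hmu : 0 < mu) [IsProbabilityMeasure (expMeasure mu)]
    {R : Set (ℕ → ℝ)} (hR : MeasurableSet R) (n : ℕ) {x : ℝ} (hx : 0 ≤ x) :
    iidLaw (expMeasure mu) {χ | countTo x χ = n ∧ residualSpacings x χ ∈ R}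
      = ENNReal.ofReal (poissonWeight (mu * x) n) * iidLaw (expMeasure mu) R := by
  rw [← iidLaw_exp_points hmu hR n hx]
  refine measure_congr ?_
  filter_upwards [ae_iidLaw_tendsto_epoch (expMeasure_Iic_zero hmu)] with χ hχ
  have hex : ∃ n, x < epoch χ n := (hχ.eventually_gt_atTop x).exists
  refine propext ?_
  change (countTo x χ = n ∧ residualSpacings x χ ∈ R) ↔ ((∀ m < n, epoch χ m ≤ x) ∧ x < epoch χ n ∧
        seqCons (epoch χ n - x) (seqDrop (n + 1) χ) ∈ R)
  rw [← and_assoc, ← countTo_eq_iff hex]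
  refine and_congr_right fun h => ?_
  rw [residualSpacings, h]

/-- The law of the number of points of a Poisson process of rate `mu` in an independent random
interval whose length has law `B`. -/
noncomputable def mixedPoissonLaw (mu : ℝ) (B : Measure ℝ) : Measure ℕ :=
  (B.prod (iidLaw (expMeasure mu))).map (fun p => countTo p.1 p.2)

lemma mixedPoissonLaw_singleton {mu : ℝ} (hmu : 0 < mu) [IsProbabilityMeasure (expMeasure mu)]
    {B : Measure ℝ} [IsProbabilityMeasure B] (hB : B (Set.Iic 0) = 0) (n : ℕ) :
    mixedPoissonLaw mu B {n} = ∫⁻ x, ENNReal.ofReal (poissonWeight (mu * x) n) ∂B := by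
  rw [mixedPoissonLaw, Measure.map_apply measurable_countTo (measurableSet_singleton n),
    Measure.prod_apply (measurable_countTo (measurableSet_singleton n))]
  refine lintegral_congr_ae ?_
  filter_upwards [ae_pos_of_measure_Iic_zero hB] with x hx
  have := iidLaw_exp_countTo_residualSpacings hmu MeasurableSet.univ n hx.le
  rw [measure_univ, mul_one] at this
  rw [← this]
  congr 1
  ext χ
  simp

/-- One step along the successive intervals with lengths `e.1`: the number of points, with
spacings `e.2`, in the first interval, and the data seen from its end. -/
noncomputable def countStep (e : (ℕ → ℝ) × (ℕ → ℝ)) : ℕ × ((ℕ → ℝ) × (ℕ → ℝ)) :=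
  (countTo (e.1 0) e.2, (seqDrop 1 e.1, residualSpacings (e.1 0) e.2))

lemma measurable_countStep : Measurable countStep := by
  have h : Measurable (fun e : (ℕ → ℝ) × (ℕ → ℝ) => (e.1 0, e.2)) := by fun_prop
  have h1 : Measurable (fun e : (ℕ → ℝ) × (ℕ → ℝ) => countTo (e.1 0) e.2) :=
    measurable_countTo.comp h
  have h2 : Measurable (fun e : (ℕ → ℝ) × (ℕ → ℝ) => residualSpacings (e.1 0) e.2) := by
    have := measurable_residualSpacings.comp h
    exact this
  have h3 : Measurable (fun e : (ℕ → ℝ) × (ℕ → ℝ) => seqDrop 1 e.1) := by fun_prop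
  exact h1.prodMk (h3.prodMk h2)

lemma map_countStep {mu : ℝ} (hmu : 0 < mu) [IsProbabilityMeasure (expMeasure mu)]
    {B : Measure ℝ} [IsProbabilityMeasure B] (hB : B (Set.Iic 0) = 0) :
    ((iidLaw B).prod (iidLaw (expMeasure mu))).map countStep
      = (mixedPoissonLaw mu B).prod ((iidLaw B).prod (iidLaw (expMeasure mu))) := by
  set ν := iidLaw (expMeasure mu) with hν
  set m := (iidLaw B).prod ν with hm
  have : IsProbabilityMeasure (mixedPoissonLaw mu B) :=
    Measure.isProbabilityMeasure_map measurable_countTo.aemeasurable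
  have key : ∀ (R : Set ((ℕ → ℝ) × (ℕ → ℝ))), MeasurableSet R → ∀ n : ℕ,
      m (countStep ⁻¹' ({n} ×ˢ R)) = mixedPoissonLaw mu B {n} * m R := by
    intro R hR n
    have hpre := measurable_countStep ((measurableSet_singleton n).prod hR)
    have hsecm : Measurable fun s : ℕ → ℝ => ν (Prod.mk s ⁻¹' R) := measurable_measure_prodMk_left hR
    have hw : Measurable fun x : ℝ => ENNReal.ofReal (poissonWeight (mu * x) n) := by fun_prop
    rw [hm, Measure.prod_apply hpre, Measure.prod_apply hR, mixedPoissonLaw_singleton hmu hB]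
    have h1 : ∀ᵐ T ∂iidLaw B, ν (Prod.mk T ⁻¹' (countStep ⁻¹' ({n} ×ˢ R)))
        = ENNReal.ofReal (poissonWeight (mu * T 0) n) * ν (Prod.mk (seqDrop 1 T) ⁻¹' R) := by
      filter_upwards [ae_iidLaw_pos hB] with T hT
      rw [← iidLaw_exp_countTo_residualSpacings hmu (measurable_prodMk_left hR) n (hT 0).le]
      congr 1
    rw [lintegral_congr_ae h1, lintegral_iidLaw_cons]
    · simp_rw [seqDrop_succ_seqCons]
      have h2 : ∀ (x : ℝ) (s : ℕ → ℝ), seqCons x s 0 = x := fun _ _ => rfl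
      simp_rw [h2, seqDrop_zero]
      rw [← lintegral_mul_const _ hw]
      exact lintegral_congr fun x => lintegral_const_mul _ hsecm
    · exact (hw.comp (measurable_pi_apply 0)).mul (hsecm.comp (measurable_seqDrop 1))
  refine (Measure.prod_eq fun s R hs hR => ?_).symm
  have hext : ((m.map countStep).restrict (Set.univ ×ˢ R)).map Prod.fst
      = m R • mixedPoissonLaw mu B := by
    refine Measure.ext_iff_singleton.2 fun n => ?_
    rw [Measure.map_apply measurable_fst (measurableSet_singleton n),
      Measure.restrict_apply (measurable_fst (measurableSet_singleton n)), Measure.smul_apply,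
      smul_eq_mul, mul_comm, ← key R hR n, ← Measure.map_apply measurable_countStep
        ((measurableSet_singleton n).prod hR)]
    congr 1
    ext p; simp
  have h4 := congrArg (fun μ : Measure ℕ => μ s) hext
  rw [Measure.map_apply measurable_fst hs, Measure.restrict_apply (measurable_fst hs),
    Measure.smul_apply, smul_eq_mul, mul_comm] at h4
  rw [← h4]
  congr 1
  ext p; simp

/-! ### Thinning a renewal process -/

/-- The index of the first term of `s` in `H`, and `0` if there is none. -/
noncomputable def firstHit {S : Type*} (H : Set S) (s : ℕ → S) : ℕ := sInf {n | s n ∈ H}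

/-- One step along the successive terms of `s` in `H`: the sum of the weights `w` of the terms up to
and including the first one in `H`, and the terms that come after it. -/
noncomputable def blockStep {S : Type*} (w : S → ℝ) (H : Set S) (s : ℕ → S) : ℝ × (ℕ → S) :=
  (∑ i ∈ Finset.range (firstHit H s + 1), w (s i), seqDrop (firstHit H s + 1) s)

lemma measurable_firstHit {S : Type*} [MeasurableSpace S] {H : Set S} (hH : MeasurableSet H) :
    Measurable (firstHit H) :=
  measurable_nat_sInf (p := fun (s : ℕ → S) n => s n ∈ H) fun n => measurable_pi_apply n hH

lemma measurable_blockStep {S : Type*} [MeasurableSpace S] {w : S → ℝ} (hw : Measurable w)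
    {H : Set S} (hH : MeasurableSet H) : Measurable (blockStep w H) := by
  have h : Measurable (fun q : ℕ × (ℕ → S) =>
      (∑ i ∈ Finset.range (q.1 + 1), w (q.2 i), seqDrop (q.1 + 1) q.2)) := by
    refine measurable_from_prod_countable_right fun n => ?_
    have h1 : Measurable fun s : ℕ → S => ∑ i ∈ Finset.range (n + 1), w (s i) := by fun_prop
    exact h1.prodMk (measurable_seqDrop (n + 1))
  have := h.comp ((measurable_firstHit hH).prodMk measurable_id)
  exact this

lemma ae_iidLaw_frequently_mem {S : Type*} [MeasurableSpace S] {μ : Measure S}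
    [IsProbabilityMeasure μ] {H : Set S} (hH : MeasurableSet H) (hpos : μ H ≠ 0) :
    ∀ᵐ s ∂iidLaw μ, ∃ᶠ n in atTop, s n ∈ H :=
  ae_frequently_mem (X := fun n (s : ℕ → S) => s n) (fun n => measurable_pi_apply n)
    (iIndepFun_infinitePi (P := fun _ : ℕ => μ) (X := fun _ x => x) (fun _ => measurable_id))
    (fun n => Measure.infinitePi_map_eval (fun _ : ℕ => μ) n) hH hpos

/-- Up to the first term in `H`, an i.i.d. sequence is independent of what comes later, and what
comes later has the law of the whole sequence. -/
lemma map_blockStep {S : Type*} [MeasurableSpace S] {μ : Measure S} [IsProbabilityMeasure μ]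
    {w : S → ℝ} (hw : Measurable w) {H : Set S} (hH : MeasurableSet H) (hpos : μ H ≠ 0) :
    (iidLaw μ).map (blockStep w H)
      = ((iidLaw μ).map fun s => (blockStep w H s).1).prod (iidLaw μ) := by
  have hm := measurable_blockStep hw hH
  have hm1 : Measurable fun s => (blockStep w H s).1 := measurable_fst.comp hm
  have : IsProbabilityMeasure ((iidLaw μ).map fun s => (blockStep w H s).1) :=
    Measure.isProbabilityMeasure_map hm1.aemeasurable
  refine (Measure.prod_eq fun A R hA hR => ?_).symm
  -- the event that the first hit has index `n` and the sum of the weights lies in `A`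
  let F : ℕ → Set (ℕ → S) := fun n =>
    {s | ((∀ m < n, s m ∉ H) ∧ s n ∈ H) ∧ ∑ i ∈ Finset.range (n + 1), w (s i) ∈ A}
  have hF : ∀ n, MeasurableSet (F n) := fun n => by
    have h1 : Measurable fun s : ℕ → S => ∑ i ∈ Finset.range (n + 1), w (s i) := by fun_prop
    have : F n = ((⋂ m : ℕ, ⋂ _ : m < n, ((fun s : ℕ → S => s m) ⁻¹' H)ᶜ) ∩
        (fun s : ℕ → S => s n) ⁻¹' H) ∩ (fun s => ∑ i ∈ Finset.range (n + 1), w (s i)) ⁻¹' A := by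
      ext s; simp [F]
    rw [this]
    exact ((MeasurableSet.iInter fun m => MeasurableSet.iInter fun _ =>
      (measurable_pi_apply m hH).compl).inter (measurable_pi_apply n hH)).inter (h1 hA)
  have hdisj : ∀ R : Set (ℕ → S), Pairwise (Function.onFun Disjoint
      fun n => F n ∩ seqDrop (n + 1) ⁻¹' R) := by
    intro R i j hij
    refine Set.disjoint_left.2 fun s hi hj => hij ?_
    have hex : ∃ n, s n ∈ H := ⟨i, hi.1.1.2⟩
    rw [← (nat_sInf_eq_iff hex i).2 hi.1.1, ← (nat_sInf_eq_iff hex j).2 hj.1.1]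
  have key : ∀ R : Set (ℕ → S), MeasurableSet R → iidLaw μ (blockStep w H ⁻¹' (A ×ˢ R))
      = (∑' n, iidLaw μ (F n)) * iidLaw μ R := by
    intro R hR
    have hae : blockStep w H ⁻¹' (A ×ˢ R) =ᵐ[iidLaw μ] ⋃ n, F n ∩ seqDrop (n + 1) ⁻¹' R := by
      filter_upwards [ae_iidLaw_frequently_mem hH hpos] with s hs
      have hex : ∃ n, s n ∈ H := hs.exists
      refine propext ?_
      change blockStep w H s ∈ A ×ˢ R ↔ s ∈ ⋃ n, F n ∩ seqDrop (n + 1) ⁻¹' R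
      simp only [Set.mem_iUnion, Set.mem_prod, blockStep]
      refine ⟨fun h => ⟨firstHit H s, ⟨(nat_sInf_eq_iff hex _).1 rfl, h.1⟩, h.2⟩, ?_⟩
      rintro ⟨n, ⟨h1, h2⟩, h3⟩
      have : firstHit H s = n := (nat_sInf_eq_iff hex n).2 h1
      rw [this]
      exact ⟨h2, h3⟩
    rw [measure_congr hae, measure_iUnion (hdisj R)
      fun n => (hF n).inter (measurable_seqDrop _ hR), ← ENNReal.tsum_mul_right]
    refine tsum_congr fun n => iidLaw_inter_seqDrop μ (n + 1) (hF n) hR ?_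
    rintro s s' hs ⟨⟨h1, h2⟩, h3⟩
    refine ⟨⟨fun m hm => ?_, ?_⟩, ?_⟩
    · rw [← hs m (by omega)]; exact h1 m hm
    · rw [← hs n (by omega)]; exact h2
    · rwa [← Finset.sum_congr rfl fun i hi => congrArg w (hs i (Finset.mem_range.1 hi))]
  rw [Measure.map_apply hm (hA.prod hR), key R hR, Measure.map_apply hm1 hA]
  have := key Set.univ MeasurableSet.univ
  rw [measure_univ, mul_one] at this
  rw [← this]
  congr 2
  ext s; simp

lemma nth_firstHit_zero {S : Type*} (H : Set S) (s : ℕ → S) :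
    Nat.nth (fun n => s n ∈ H) 0 = firstHit H s := by
  rw [Nat.nth_zero, firstHit]

lemma nth_succ_eq_add_nth {S : Type*} {H : Set S} {s : ℕ → S} (h : ∃ᶠ n in atTop, s n ∈ H)
    (j : ℕ) : Nat.nth (fun n => s n ∈ H) (j + 1) = firstHit H s + 1
      + Nat.nth (fun n => seqDrop (firstHit H s + 1) s n ∈ H) j := by
  classical
  have hinf : {n | s n ∈ H}.Infinite := Nat.frequently_atTop_iff_infinite.1 h
  have hinf' : {n | seqDrop (firstHit H s + 1) s n ∈ H}.Infinite := by
    refine Nat.frequently_atTop_iff_infinite.1 (frequently_atTop.2 fun a => ?_)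
    obtain ⟨b, hb, hb'⟩ := frequently_atTop.1 h (firstHit H s + 1 + a)
    refine ⟨b - (firstHit H s + 1), by omega, ?_⟩
    simpa [seqDrop, Nat.add_sub_cancel' (show firstHit H s + 1 ≤ b by omega)] using hb'
  set i := Nat.nth (fun n => seqDrop (firstHit H s + 1) s n ∈ H) j with hi
  have hmem : s (firstHit H s + 1 + i) ∈ H :=
    Nat.nth_mem_of_infinite (p := fun n => seqDrop (firstHit H s + 1) s n ∈ H) hinf' j
  rw [← Nat.nth_count (p := fun n => s n ∈ H) hmem]
  congr 1
  rw [Nat.count_add, Nat.count_succ, ← nth_firstHit_zero,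
    Nat.count_nth_of_infinite (p := fun n => s n ∈ H) hinf 0,
    if_pos (Nat.nth_mem_of_infinite (p := fun n => s n ∈ H) hinf 0), nth_firstHit_zero]
  have := Nat.count_nth_of_infinite (p := fun n => seqDrop (firstHit H s + 1) s n ∈ H) hinf' j
  rw [← hi] at this
  refine (show j + 1 = 0 + 1 + j by omega).trans (congrArg (0 + 1 + ·) ?_)
  simp only [seqDrop] at this
  convert! this.symm

/-- The partial sums of the block weights are the partial sums of the weights up to the successive
terms in `H`. -/
lemma epoch_outputs_blockStep {S : Type*} {w : S → ℝ} {H : Set S} {s : ℕ → S}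
    (h : ∃ᶠ n in atTop, s n ∈ H) (j : ℕ) :
    epoch (outputs (blockStep w H) s) j
      = epoch (fun n => w (s n)) (Nat.nth (fun n => s n ∈ H) j) := by
  induction j generalizing s with
  | zero =>
    rw [nth_firstHit_zero]
    simp [epoch, outputs_zero, blockStep]
  | succ j ih =>
    have h' : ∃ᶠ n in atTop, (blockStep w H s).2 n ∈ H := by
      refine frequently_atTop.2 fun a => ?_
      obtain ⟨b, hb, hb'⟩ := frequently_atTop.1 h (firstHit H s + 1 + a)
      refine ⟨b - (firstHit H s + 1), by omega, ?_⟩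
      simpa [blockStep, seqDrop, Nat.add_sub_cancel' (show firstHit H s + 1 ≤ b by omega)] using hb'
    have hd : seqDrop 1 (outputs (blockStep w H) s) = outputs (blockStep w H) (blockStep w H s).2 := by
      funext n
      simp only [seqDrop, Nat.add_comm 1 n, outputs_succ]
    rw [epoch_succ_eq_add_drop, hd, ih h', nth_succ_eq_add_nth h, outputs_zero]
    simp only [epoch, blockStep, seqDrop]
    rw [show firstHit H s + 1 + Nat.nth (fun n => s (firstHit H s + 1 + n) ∈ H) j + 1
      = (firstHit H s + 1) + (Nat.nth (fun n => s (firstHit H s + 1 + n) ∈ H) j + 1) by omega]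
    exact (Finset.sum_range_add _ _ _).symm

/-! ### Counts of points in successive intervals -/

lemma exists_lt_epoch {χ : ℕ → ℝ} (h : Tendsto (epoch χ) atTop atTop) (x : ℝ) :
    ∃ n, x < epoch χ n := (h.eventually_gt_atTop x).exists

lemma pointCount_eq_countTo {χ : ℕ → ℝ} (hpos : ∀ n, 0 < χ n)
    (h : Tendsto (epoch χ) atTop atTop) (x : ℝ) : pointCount χ x = countTo x χ := by
  have h1 := (countTo_eq_iff (exists_lt_epoch h x) _).1 rfl
  have : {n | epoch χ n ≤ x} = (Finset.range (countTo x χ) : Set ℕ) := by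
    ext n
    simp only [Set.mem_ofPred_eq, Finset.coe_range, Set.mem_Iio]
    refine ⟨fun hn => ?_, h1.1 n⟩
    by_contra! hle
    exact absurd hn (not_le.2 (h1.2.trans_le ((strictMono_epoch hpos).monotone hle)))
  rw [pointCount, this, Set.ncard_coe_finset, Finset.card_range]

lemma epoch_residualSpacings (x : ℝ) (χ : ℕ → ℝ) (m : ℕ) :
    epoch (residualSpacings x χ) m = epoch χ (countTo x χ + m) - x := by
  cases m with
  | zero => rw [residualSpacings, epoch_seqCons_zero, Nat.add_zero]
  | succ m =>
    rw [residualSpacings, epoch_seqCons_succ]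
    have : epoch χ (countTo x χ + (m + 1))
        = epoch χ (countTo x χ) + epoch (seqDrop (countTo x χ + 1) χ) m := by
      simp only [epoch, seqDrop]
      rw [← Finset.sum_range_add]
      congr 2
      omega
    rw [this]
    ring

lemma residualSpacings_pos {χ : ℕ → ℝ} (hpos : ∀ n, 0 < χ n)
    (h : Tendsto (epoch χ) atTop atTop) (x : ℝ) (n : ℕ) : 0 < residualSpacings x χ n := by
  cases n with
  | zero => exact sub_pos.2 ((countTo_eq_iff (exists_lt_epoch h x) _).1 rfl).2
  | succ n => exact hpos _

lemma tendsto_epoch_residualSpacings {χ : ℕ → ℝ} (h : Tendsto (epoch χ) atTop atTop) (x : ℝ) :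
    Tendsto (epoch (residualSpacings x χ)) atTop atTop := by
  have : epoch (residualSpacings x χ) = fun m => epoch χ (countTo x χ + m) - x :=
    funext (epoch_residualSpacings x χ)
  rw [this]
  exact tendsto_atTop_add_const_right _ _ (h.comp (tendsto_atTop_mono (fun n => Nat.le_add_left n _) tendsto_id))

lemma countTo_add {χ : ℕ → ℝ} (h : Tendsto (epoch χ) atTop atTop) (x : ℝ) {y : ℝ} (hy : 0 ≤ y) :
    countTo (x + y) χ = countTo x χ + countTo y (residualSpacings x χ) := by
  have h1 := (countTo_eq_iff (exists_lt_epoch h x) _).1 rfl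
  have h2 := (countTo_eq_iff (exists_lt_epoch (tendsto_epoch_residualSpacings h x) y) _).1 rfl
  refine (countTo_eq_iff (exists_lt_epoch h _) _).2 ⟨fun m hm => ?_, ?_⟩
  · rcases lt_or_ge m (countTo x χ) with hlt | hge
    · exact (h1.1 m hlt).trans (by linarith)
    · obtain ⟨i, rfl⟩ := Nat.exists_eq_add_of_le hge
      have := h2.1 i (by omega)
      rw [epoch_residualSpacings] at this
      linarith
  · have := h2.2
    rw [epoch_residualSpacings] at this
    linarith

/-- The outputs of `countStep` are the numbers of points in the successive intervals. -/
lemma pointCount_epoch {T χ : ℕ → ℝ} (hT : ∀ n, 0 < T n) (hpos : ∀ n, 0 < χ n)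
    (h : Tendsto (epoch χ) atTop atTop) (j : ℕ) :
    pointCount χ (epoch T j) = ∑ i ∈ Finset.range (j + 1), ((outputs countStep (T, χ) i : ℕ) : ℤ) := by
  rw [pointCount_eq_countTo hpos h]
  norm_cast
  induction j generalizing T χ with
  | zero => simp [epoch, outputs_zero, countStep]
  | succ j ih =>
    have hT' : ∀ n, 0 < seqDrop 1 T n := fun n => hT _
    have h0 : 0 ≤ epoch (seqDrop 1 T) j := Finset.sum_nonneg fun i _ => (hT' i).le
    rw [epoch_succ_eq_add_drop, countTo_add h _ h0, Finset.sum_range_succ',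
      ih hT' (residualSpacings_pos hpos h _) (tendsto_epoch_residualSpacings h _), add_comm]
    simp only [outputs_succ, outputs_zero, countStep]

/-! ### Jumps of counting processes -/

lemma finite_epoch_le {s : ℕ → ℝ} (h : Tendsto (epoch s) atTop atTop) (t : ℝ) :
    {n | epoch s n ≤ t}.Finite := by
  have := h.eventually_gt_atTop t
  rw [← Nat.cofinite_eq_atTop, eventually_cofinite] at this
  simpa using this

lemma eventually_left_epoch_le_iff {s : ℕ → ℝ} (h : Tendsto (epoch s) atTop atTop) (t : ℝ) :
    ∀ᶠ u in 𝓝[<] t, ∀ n, epoch s n ≤ u ↔ epoch s n < t := by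
  have h1 : ∀ᶠ u in 𝓝[<] t, ∀ n ∈ {n | epoch s n ≤ t}, epoch s n < t → epoch s n ≤ u := by
    refine (eventually_all_finite (finite_epoch_le h t)).2 fun n _ => ?_
    by_cases hn : epoch s n < t
    · filter_upwards [mem_nhdsWithin_of_mem_nhds (Ioi_mem_nhds hn)] with u hu _
      exact (Set.mem_Ioi.1 hu).le
    · exact Eventually.of_forall fun u h => absurd h hn
  filter_upwards [h1, self_mem_nhdsWithin] with u hu hut n
  exact ⟨fun h => h.trans_lt hut, fun h => hu n h.le h⟩

lemma eventually_right_epoch_le_iff {s : ℕ → ℝ} (h : Tendsto (epoch s) atTop atTop) (t : ℝ) :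
    ∀ᶠ u in 𝓝[≥] t, ∀ n, epoch s n ≤ u ↔ epoch s n ≤ t := by
  have h1 : ∀ᶠ u in 𝓝[≥] t, ∀ n ∈ {n | epoch s n ≤ t + 1}, t < epoch s n → u < epoch s n := by
    refine (eventually_all_finite (finite_epoch_le h _)).2 fun n _ => ?_
    by_cases hn : t < epoch s n
    · filter_upwards [mem_nhdsWithin_of_mem_nhds (Iio_mem_nhds hn)] with u hu _
      exact hu
    · exact Eventually.of_forall fun u h => absurd h hn
  filter_upwards [h1, self_mem_nhdsWithin, mem_nhdsWithin_of_mem_nhds (Iio_mem_nhds (lt_add_one t))]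
    with u hu htu hu1 n
  refine ⟨fun h => ?_, fun h => h.trans htu⟩
  by_contra! hlt
  exact absurd (hu n (h.trans (Set.mem_Iio.1 hu1).le) hlt) (not_lt.2 h)

lemma leftLim_eq_of_eventuallyEq_const {Z : ℝ → ℤ} {t : ℝ} {z : ℤ} (h : ∀ᶠ u in 𝓝[<] t, Z u = z) :
    Function.leftLim Z t = z :=
  leftLim_eq_of_tendsto (tendsto_const_nhds.congr' (h.mono fun _ h => h.symm))

lemma eventually_left_pointCount {s : ℕ → ℝ} (h : Tendsto (epoch s) atTop atTop) (t : ℝ) :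
    ∀ᶠ u in 𝓝[<] t, pointCount s u = ({n | epoch s n < t}.ncard : ℤ) := by
  filter_upwards [eventually_left_epoch_le_iff h t] with u hu
  simp only [pointCount, hu]

lemma leftLim_pointCount {s : ℕ → ℝ} (h : Tendsto (epoch s) atTop atTop) (t : ℝ) :
    Function.leftLim (pointCount s) t = ({n | epoch s n < t}.ncard : ℤ) :=
  leftLim_eq_of_eventuallyEq_const (eventually_left_pointCount h t)

lemma leftLim_departureProcess {s : ℕ → ℝ} (h : Tendsto (epoch s) atTop atTop) (C : ℕ) (t : ℝ) :
    Function.leftLim (departureProcess C s) t = C * Function.leftLim (pointCount s) t := by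
  rw [leftLim_pointCount h]
  refine leftLim_eq_of_eventuallyEq_const ?_
  filter_upwards [eventually_left_pointCount h t] with u hu
  rw [departureProcess, hu]

lemma leftLim_pointCount_le {s : ℕ → ℝ} (h : Tendsto (epoch s) atTop atTop) (t : ℝ) :
    Function.leftLim (pointCount s) t ≤ pointCount s t := by
  rw [leftLim_pointCount h, pointCount]
  exact_mod_cast Set.ncard_le_ncard (fun n (hn : epoch s n < t) => hn.le) (finite_epoch_le h t)

lemma leftLim_pointCount_eq {s : ℕ → ℝ} (h : Tendsto (epoch s) atTop atTop) {t : ℝ}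
    (ht : ∀ n, epoch s n ≠ t) : Function.leftLim (pointCount s) t = pointCount s t := by
  rw [leftLim_pointCount h, pointCount]
  congr 2
  ext n
  exact ⟨fun hn : epoch s n < t => hn.le, fun hn : epoch s n ≤ t => lt_of_le_of_ne hn (ht n)⟩

lemma jump_departureProcess {s : ℕ → ℝ} (h : Tendsto (epoch s) atTop atTop) (C : ℕ) (t : ℝ) :
    jump (departureProcess C s) t
      = C * (pointCount s t - Function.leftLim (pointCount s) t) := by
  rw [jump, leftLim_departureProcess h, departureProcess, mul_sub]

lemma jump_departureProcess_nonneg {s : ℕ → ℝ} (h : Tendsto (epoch s) atTop atTop) (C : ℕ)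
    (t : ℝ) : 0 ≤ jump (departureProcess C s) t := by
  rw [jump_departureProcess h]
  exact mul_nonneg (by positivity) (sub_nonneg.2 (leftLim_pointCount_le h t))

lemma leftLim_classCount {ℓ : ℕ} {s : ℕ → ℝ} (h : Tendsto (epoch s) atTop atTop) (c : ℕ → Fin ℓ)
    (i : Fin ℓ) (t : ℝ) :
    Function.leftLim (classCount s c i) t = ({n | epoch s n < t ∧ c n = i}.ncard : ℤ) := by
  refine leftLim_eq_of_eventuallyEq_const ?_
  filter_upwards [eventually_left_epoch_le_iff h t] with u hu
  simp only [classCount, hu]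

lemma jump_classCount_eq_zero {ℓ : ℕ} {s : ℕ → ℝ} (h : Tendsto (epoch s) atTop atTop)
    {c : ℕ → Fin ℓ} {i : Fin ℓ} {t : ℝ} (ht : ∀ n, epoch s n = t → c n ≠ i) :
    jump (classCount s c i) t = 0 := by
  rw [jump, leftLim_classCount h, classCount, sub_eq_zero]
  congr 2
  ext n
  exact ⟨fun hn => ⟨lt_of_le_of_ne hn.1 fun h => ht n h hn.2, hn.2⟩, fun hn => ⟨hn.1.le, hn.2⟩⟩

lemma jump_classCount_eq_one {ℓ : ℕ} {s : ℕ → ℝ} (hpos : ∀ n, 0 < s n)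
    (h : Tendsto (epoch s) atTop atTop) (c : ℕ → Fin ℓ) (n : ℕ) :
    jump (classCount s c (c n)) (epoch s n) = 1 := by
  have hfin : {m | epoch s m < epoch s n ∧ c m = c n}.Finite :=
    (finite_epoch_le h (epoch s n)).subset fun m hm => hm.1.le
  have : {m | epoch s m ≤ epoch s n ∧ c m = c n}
      = insert n {m | epoch s m < epoch s n ∧ c m = c n} := by
    ext m
    simp only [Set.mem_ofPred_eq, Set.mem_insert_iff, (strictMono_epoch hpos).le_iff_le,
      (strictMono_epoch hpos).lt_iff_lt]
    constructor
    · rintro ⟨h1, h2⟩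
      rcases h1.eq_or_lt with h | h
      · exact Or.inl h
      · exact Or.inr ⟨h, h2⟩
    · rintro (rfl | ⟨h1, h2⟩)
      · exact ⟨le_rfl, rfl⟩
      · exact ⟨h1.le, h2⟩
  rw [jump, leftLim_classCount h, classCount, this, Set.ncard_insert_of_notMem (by simp) hfin]
  push_cast
  ring

lemma jump_classCount_nonneg {ℓ : ℕ} {s : ℕ → ℝ} (hpos : ∀ n, 0 < s n)
    (h : Tendsto (epoch s) atTop atTop) (c : ℕ → Fin ℓ) (i : Fin ℓ) (t : ℝ) :
    0 ≤ jump (classCount s c i) t := by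
  by_cases hex : ∃ n, epoch s n = t ∧ c n = i
  · obtain ⟨n, rfl, rfl⟩ := hex
    rw [jump_classCount_eq_one hpos h]
    exact zero_le_one
  · push Not at hex
    rw [jump_classCount_eq_zero h hex]

/-! ### The cumulative buffer content along a path -/

/-- Two right-continuous integer-valued paths that start equal stay equal if equality before a time
propagates to that time. -/
lemma eqOn_Ico_of_left_propagation {f g : ℝ → ℤ} {a b : ℝ} (h0 : f a = g a)
    (hf : ∀ u ∈ Set.Ico a b, ContinuousWithinAt f (Set.Ici u) u)
    (hg : ∀ u ∈ Set.Ico a b, ContinuousWithinAt g (Set.Ici u) u)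
    (hstep : ∀ u ∈ Set.Ioo a b, (∀ v ∈ Set.Ico a u, f v = g v) → f u = g u) :
    ∀ u ∈ Set.Ico a b, f u = g u := by
  by_contra! hbad
  let S : Set ℝ := {u | u ∈ Set.Ico a b ∧ f u ≠ g u}
  obtain ⟨u₀, hu₀⟩ := hbad
  have hne : S.Nonempty := ⟨u₀, hu₀⟩
  have hbdd : BddBelow S := ⟨a, fun u hu => hu.1.1⟩
  have hi_a : a ≤ sInf S := le_csInf hne fun u hu => hu.1.1
  have hi_b : sInf S < b := (csInf_le hbdd hu₀).trans_lt hu₀.1.2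
  have hbefore : ∀ v ∈ Set.Ico a (sInf S), f v = g v := fun v hv => by
    by_contra h
    exact absurd (csInf_le hbdd ⟨⟨hv.1, hv.2.trans hi_b⟩, h⟩) (not_le.2 hv.2)
  have hat : f (sInf S) = g (sInf S) := by
    rcases hi_a.eq_or_lt with h | h
    · rw [← h]; exact h0
    · exact hstep _ ⟨h, hi_b⟩ hbefore
  have hfe : ∀ᶠ u in 𝓝[≥] (sInf S), f u = f (sInf S) :=
    (hf _ ⟨hi_a, hi_b⟩).eventually (eventually_of_mem (IsOpen.mem_nhds (isOpen_discrete {f (sInf S)}) rfl)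
      fun _ h => h)
  have hge : ∀ᶠ u in 𝓝[≥] (sInf S), g u = g (sInf S) :=
    (hg _ ⟨hi_a, hi_b⟩).eventually (eventually_of_mem (IsOpen.mem_nhds (isOpen_discrete {g (sInf S)}) rfl)
      fun _ h => h)
  obtain ⟨d, hd, hsub⟩ := mem_nhdsGE_iff_exists_Ico_subset.1 (hfe.and hge)
  have : d ≤ sInf S := le_csInf hne fun u hu => by
    by_contra! hlt
    have := hsub ⟨csInf_le hbdd hu, hlt⟩
    exact hu.2 (by rw [this.1, this.2, hat])
  exact absurd hd (not_lt.2 this)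

section Path

variable {ℓ : ℕ} {A : Fin ℓ → ℝ → ℤ} {D : ℝ → ℤ} {Q : Fin ℓ → ℝ → ℤ}

lemma IsBufferContent.nonneg (h : IsBufferContent A D Q) (k : Fin ℓ) {t : ℝ} (ht : 0 ≤ t) :
    0 ≤ Q k t := by
  rcases ht.eq_or_lt with rfl | ht
  · exact (h.start k).ge
  · rw [h.equation k t ht]
    exact le_max_left _ _

lemma IsBufferContent.tendsto_leftLim (h : IsBufferContent A D Q) (k : Fin ℓ) {t : ℝ}
    (ht : 0 < t) : Tendsto (Q k) (𝓝[<] t) (𝓝 (Function.leftLim (Q k) t)) := by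
  obtain ⟨y, hy⟩ := h.left_limits k t ht
  rwa [leftLim_eq_of_tendsto hy]

lemma IsBufferContent.leftLim_nonneg (h : IsBufferContent A D Q) (k : Fin ℓ) {t : ℝ}
    (ht : 0 < t) : 0 ≤ Function.leftLim (Q k) t :=
  ge_of_tendsto (h.tendsto_leftLim k ht) (by
    filter_upwards [mem_nhdsWithin_of_mem_nhds (Ioi_mem_nhds ht)] with u hu
    exact h.nonneg k (Set.mem_Ioi.1 hu).le)

lemma IsBufferContent.tendsto_leftLim_sum (h : IsBufferContent A D Q) (s : Finset (Fin ℓ)) {t : ℝ}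
    (ht : 0 < t) : Tendsto (fun u => ∑ i ∈ s, Q i u) (𝓝[<] t)
      (𝓝 (∑ i ∈ s, Function.leftLim (Q i) t)) :=
  tendsto_finsetSum _ fun i _ => h.tendsto_leftLim i ht

lemma IsBufferContent.leftLim_higherContent (h : IsBufferContent A D Q) (k : Fin ℓ) {t : ℝ}
    (ht : 0 < t) : Function.leftLim (higherContent Q k) t
      = ∑ i ∈ Finset.Iio k, Function.leftLim (Q i) t :=
  leftLim_eq_of_tendsto (h.tendsto_leftLim_sum _ ht)

lemma IsBufferContent.leftLim_cumulativeContent (h : IsBufferContent A D Q) (k : Fin ℓ) {t : ℝ}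
    (ht : 0 < t) : Function.leftLim (cumulativeContent Q k) t
      = ∑ i ∈ Finset.Iic k, Function.leftLim (Q i) t :=
  leftLim_eq_of_tendsto (h.tendsto_leftLim_sum _ ht)

lemma IsBufferContent.leftLim_cumulativeContent_nonneg (h : IsBufferContent A D Q) (k : Fin ℓ)
    {t : ℝ} (ht : 0 < t) : 0 ≤ Function.leftLim (cumulativeContent Q k) t := by
  rw [h.leftLim_cumulativeContent k ht]
  exact Finset.sum_nonneg fun i _ => h.leftLim_nonneg i ht

/-- At a time without possible departures every arriving customer is added to its buffer. -/
lemma IsBufferContent.eq_leftLim_add_jump (h : IsBufferContent A D Q) {t : ℝ} (ht : 0 < t)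
    (hD : jump D t = 0) (hA : ∀ i, 0 ≤ jump (A i) t) (k : Fin ℓ) :
    Q k t = Function.leftLim (Q k) t + jump (A k) t := by
  induction k using WellFoundedLT.induction with
  | ind k ih =>
    have hle : ∀ i ∈ Finset.Iio k, Function.leftLim (Q i) t ≤ Q i t := fun i hi => by
      rw [ih i (Finset.mem_Iio.1 hi)]
      linarith [hA i]
    rw [h.equation k t ht, hD, h.leftLim_higherContent k ht]
    have hnn := h.leftLim_nonneg k ht
    have hz : (0 - ∑ i ∈ Finset.Iio k, Function.leftLim (Q i) t)
        * (if higherContent Q k t = 0 then 1 else 0) = 0 := by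
      split_ifs with h0
      · have h1 : ∑ i ∈ Finset.Iio k, Function.leftLim (Q i) t ≤ higherContent Q k t :=
          Finset.sum_le_sum hle
        have h2 : 0 ≤ ∑ i ∈ Finset.Iio k, Function.leftLim (Q i) t :=
          Finset.sum_nonneg fun i _ => h.leftLim_nonneg i ht
        omega
      · ring
    rw [hz, sub_zero, max_eq_right (add_nonneg hnn (hA k))]

lemma sum_Iic_eq_sum_Iio_add (f : Fin ℓ → ℤ) (k : Fin ℓ) :
    ∑ i ∈ Finset.Iic k, f i = ∑ i ∈ Finset.Iio k, f i + f k := by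
  rw [← Finset.Iio_insert, Finset.sum_insert (by simp), add_comm]

/-- At a time without arrivals the possible departures are used up by the buffers in the order of
their priority, so that the cumulative content behaves like the content of a single buffer. -/
lemma IsBufferContent.cumulativeContent_eq_of_no_arrival (h : IsBufferContent A D Q) {t : ℝ}
    (ht : 0 < t) (hD : 0 ≤ jump D t) (hA : ∀ i, jump (A i) t = 0) (k : Fin ℓ) :
    cumulativeContent Q k t
      = max 0 (Function.leftLim (cumulativeContent Q k) t - jump D t) := by
  induction k using WellFoundedLT.induction with
  | ind k ih =>
    have hhigh : higherContent Q k t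
        = max 0 (Function.leftLim (higherContent Q k) t - jump D t) := by
      by_cases hk : k.val = 0
      · have hI : Finset.Iio k = ∅ := by
          ext i; simp [Fin.lt_def, hk]
        rw [h.leftLim_higherContent k ht, higherContent, hI]
        simp [hD]
      · let j : Fin ℓ := ⟨k.val - 1, by omega⟩
        have hI : Finset.Iio k = Finset.Iic j := by
          ext i
          simp only [Finset.mem_Iio, Finset.mem_Iic, Fin.lt_def, Fin.le_def, j]
          omega
        have := ih j (by simp only [Fin.lt_def, j]; omega)
        rw [h.leftLim_cumulativeContent j ht, cumulativeContent] at this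
        rw [h.leftLim_higherContent k ht, higherContent, hI, this]
    have heq := h.equation k t ht
    have hnn := h.leftLim_nonneg k ht
    have e1 : cumulativeContent Q k t = higherContent Q k t + Q k t :=
      sum_Iic_eq_sum_Iio_add (fun i => Q i t) k
    have e2 : Function.leftLim (cumulativeContent Q k) t
        = Function.leftLim (higherContent Q k) t + Function.leftLim (Q k) t := by
      rw [h.leftLim_cumulativeContent k ht, h.leftLim_higherContent k ht]
      exact sum_Iic_eq_sum_Iio_add (fun i => Function.leftLim (Q i) t) k
    rw [hA k] at heq
    rw [e1, e2]
    split_ifs at heq with h0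
    · rw [h0] at hhigh ⊢
      omega
    · simp only [mul_zero] at heq
      omega

end Path

section Path

variable {ℓ C : ℕ} {τ χ : ℕ → ℝ} {c : ℕ → Fin ℓ} {Q : Fin ℓ → ℝ → ℤ}

lemma pointCount_right_continuous {s : ℕ → ℝ} (h : Tendsto (epoch s) atTop atTop) (t : ℝ) :
    ContinuousWithinAt (pointCount s) (Set.Ici t) t := by
  refine tendsto_const_nhds.congr' ?_
  filter_upwards [eventually_right_epoch_le_iff h t] with u hu
  simp only [pointCount, hu]

/-- If no customer of the first `k` classes arrives at time `t`, then the possible departures at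
that time reduce the cumulative content, which is cut off at zero. -/
lemma IsBufferContent.cumulativeContent_eq
    (h : IsBufferContent (classCount τ c) (departureProcess C χ) Q)
    (hτ : ∀ n, 0 < τ n) (hτt : Tendsto (epoch τ) atTop atTop)
    (hχt : Tendsto (epoch χ) atTop atTop) (hne : ∀ n m, epoch τ n ≠ epoch χ m) (k : Fin ℓ)
    {t : ℝ} (ht : 0 < t) (hno : ∀ n, epoch τ n = t → ¬ c n ≤ k) :
    cumulativeContent Q k t = max 0 (Function.leftLim (cumulativeContent Q k) t
      - jump (departureProcess C χ) t) := by
  by_cases hD : ∃ m, epoch χ m = t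
  · obtain ⟨m, rfl⟩ := hD
    exact h.cumulativeContent_eq_of_no_arrival ht (jump_departureProcess_nonneg hχt C _)
      (fun i => jump_classCount_eq_zero hτt fun n hn => absurd hn (hne n m)) k
  · push Not at hD
    have hj : jump (departureProcess C χ) t = 0 := by
      rw [jump_departureProcess hχt, leftLim_pointCount_eq hχt hD]
      ring
    have hA : ∀ i ∈ Finset.Iic k, Q i t = Function.leftLim (Q i) t := fun i hi => by
      rw [h.eq_leftLim_add_jump ht hj (fun i => jump_classCount_nonneg hτ hτt c i t) i,
        jump_classCount_eq_zero hτt, add_zero]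
      rintro n hn rfl
      exact hno n hn (Finset.mem_Iic.1 hi)
    rw [hj, sub_zero, max_eq_right (h.leftLim_cumulativeContent_nonneg k ht),
      h.leftLim_cumulativeContent k ht]
    exact Finset.sum_congr rfl hA

/-- A customer of one of the first `k` classes adds one to the cumulative content. -/
lemma IsBufferContent.cumulativeContent_epoch
    (h : IsBufferContent (classCount τ c) (departureProcess C χ) Q)
    (hτ : ∀ n, 0 < τ n) (hτt : Tendsto (epoch τ) atTop atTop)
    (hχt : Tendsto (epoch χ) atTop atTop) (hne : ∀ n m, epoch τ n ≠ epoch χ m) {k : Fin ℓ}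
    {n : ℕ} (hn : c n ≤ k) :
    cumulativeContent Q k (epoch τ n)
      = Function.leftLim (cumulativeContent Q k) (epoch τ n) + 1 := by
  have ht : 0 < epoch τ n := epoch_pos hτ n
  have hj : jump (departureProcess C χ) (epoch τ n) = 0 := by
    rw [jump_departureProcess hχt, leftLim_pointCount_eq hχt fun m => (hne n m).symm]
    ring
  have hone : ∀ i, jump (classCount τ c i) (epoch τ n) = if i = c n then 1 else 0 := fun i => by
    split_ifs with hi
    · rw [hi, jump_classCount_eq_one hτ hτt]
    · refine jump_classCount_eq_zero hτt fun m hm => ?_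
      rw [(strictMono_epoch hτ).injective hm]
      exact Ne.symm hi
  rw [h.leftLim_cumulativeContent k ht, cumulativeContent]
  simp_rw [h.eq_leftLim_add_jump ht hj (fun i => jump_classCount_nonneg hτ hτt c i _), hone]
  rw [Finset.sum_add_distrib, Finset.sum_ite_eq' _ _ _, if_pos (Finset.mem_Iic.2 hn)]

/-- If no customer of the first `k` classes arrives strictly between `s` and `t`, the cumulative
content just before `t` is what the possible departures leave of its value at `s`. -/
lemma IsBufferContent.leftLim_cumulativeContent_of_no_arrival
    (h : IsBufferContent (classCount τ c) (departureProcess C χ) Q)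
    (hτ : ∀ n, 0 < τ n) (hτt : Tendsto (epoch τ) atTop atTop)
    (hχt : Tendsto (epoch χ) atTop atTop) (hne : ∀ n m, epoch τ n ≠ epoch χ m) (k : Fin ℓ)
    {s t : ℝ} (hs : 0 ≤ s) (hst : s < t) (hno : ∀ n, epoch τ n ∈ Set.Ioo s t → ¬ c n ≤ k) :
    Function.leftLim (cumulativeContent Q k) t
      = max 0 (cumulativeContent Q k s
          - C * (Function.leftLim (pointCount χ) t - pointCount χ s)) := by
  set q := cumulativeContent Q k with hq
  let g : ℝ → ℤ := fun u => max 0 (q s - C * (pointCount χ u - pointCount χ s))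
  have hgl : ∀ u, ∀ᶠ v in 𝓝[<] u,
      g v = max 0 (q s - C * (Function.leftLim (pointCount χ) u - pointCount χ s)) := fun u => by
    rw [leftLim_pointCount hχt]
    filter_upwards [eventually_left_pointCount hχt u] with v hv
    simp only [g, hv]
  have hqs : 0 ≤ q s := Finset.sum_nonneg fun i _ => h.nonneg i hs
  have hleft : ∀ u, s < u → (∀ v ∈ Set.Ico s u, q v = g v) → Function.leftLim q u
      = max 0 (q s - C * (Function.leftLim (pointCount χ) u - pointCount χ s)) := by
    intro u hu hv
    refine leftLim_eq_of_eventuallyEq_const ?_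
    filter_upwards [hgl u, Ico_mem_nhdsLT hu] with v hv1 hv2
    rw [hv v hv2, hv1]
  refine hleft t hst (eqOn_Ico_of_left_propagation ?_ ?_ ?_ ?_)
  · simp only [g, sub_self, mul_zero, sub_zero, max_eq_right hqs]
  · intro u hu
    exact tendsto_finsetSum _ fun i _ => h.right_continuous i u (hs.trans hu.1)
  · intro u _
    have hc : Continuous fun z : ℤ => max 0 (q s - C * (z - pointCount χ s)) :=
      continuous_of_discreteTopology
    exact hc.continuousAt.comp_continuousWithinAt (pointCount_right_continuous hχt u)
  · intro u hu hv
    have hnou : ∀ n, epoch τ n = u → ¬ c n ≤ k := by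
      rintro n rfl
      exact hno n hu
    have hlim := hleft u hu.1 hv
    rw [hq] at hlim ⊢
    rw [h.cumulativeContent_eq hτ hτt hχt hne k (hs.trans_lt hu.1) hnou, hlim,
      jump_departureProcess hχt]
    have hnn := jump_departureProcess_nonneg hχt C u
    rw [jump_departureProcess hχt] at hnn
    simp only [g, ← hq]
    have e : q s - C * (pointCount χ u - pointCount χ s)
        = q s - C * (Function.leftLim (pointCount χ) u - pointCount χ s)
          - C * (pointCount χ u - Function.leftLim (pointCount χ) u) := by ring
    rw [e]
    omega

/-- The content seen by the arriving customers: started from zero it grows by one at each arrival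
and decreases, but not below zero, by `C` for each of the `N j` possible departures between the
arrivals `j - 1` and `j`. The cut-off at zero is the truncated subtraction of natural numbers, and
`N 0`, the number of points before the first arrival, plays no role because the buffers start
empty. -/
def lindleyChain (C : ℕ) (N : ℕ → ℕ) : ℕ → ℕ
  | 0 => 0
  | j + 1 => lindleyChain C N j + 1 - C * N (j + 1)

lemma no_arrival_before_nth {p : ℕ → Prop} {n : ℕ} (hn : n < Nat.nth p 0) : ¬ p n := by
  rw [Nat.nth_zero] at hn
  exact Nat.notMem_of_lt_sInf hn

lemma no_arrival_between_nth {p : ℕ → Prop} (hinf : {n | p n}.Infinite) {n j : ℕ}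
    (h1 : Nat.nth p j < n) (h2 : n < Nat.nth p (j + 1)) : ¬ p n := by
  classical
  intro hp
  rw [← Nat.nth_count hp] at h1 h2
  have h3 := (Nat.nth_strictMono hinf).lt_iff_lt.1 h1
  have h4 := (Nat.nth_strictMono hinf).lt_iff_lt.1 h2
  omega

/-- The cumulative content just before the successive arrivals to the first `k` buffers follows the
Lindley recursion driven by the numbers of possible departures between these arrivals. -/
lemma IsBufferContent.leftLim_cumulativeContent_eq_lindleyChain
    (h : IsBufferContent (classCount τ c) (departureProcess C χ) Q)
    (hτ : ∀ n, 0 < τ n) (hτt : Tendsto (epoch τ) atTop atTop) (hχ : ∀ n, 0 < χ n)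
    (hχt : Tendsto (epoch χ) atTop atTop) (hne : ∀ n m, epoch τ n ≠ epoch χ m) {k : Fin ℓ}
    (hk : ∃ᶠ n in atTop, c n ≤ k) {T : ℕ → ℝ} (hT : ∀ n, 0 < T n)
    (hTepoch : ∀ j, epoch T j = cumulativeEpoch τ c k j) (j : ℕ) :
    Function.leftLim (cumulativeContent Q k) (cumulativeEpoch τ c k j)
      = lindleyChain C (outputs countStep (T, χ)) j := by
  have hinf : {n | c n ≤ k}.Infinite := Nat.frequently_atTop_iff_infinite.1 hk
  have hpos : ∀ j, 0 < cumulativeEpoch τ c k j := fun j => epoch_pos hτ _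
  have hmono := strictMono_epoch hτ
  have hD : ∀ j, Function.leftLim (pointCount χ) (cumulativeEpoch τ c k j)
      = ∑ i ∈ Finset.range (j + 1), ((outputs countStep (T, χ) i : ℕ) : ℤ) := fun j => by
    rw [cumulativeEpoch, leftLim_pointCount_eq hχt fun m => (hne _ m).symm,
      ← cumulativeEpoch, ← hTepoch, pointCount_epoch hT hχ hχt]
  have hD' : ∀ j, pointCount χ (cumulativeEpoch τ c k j)
      = ∑ i ∈ Finset.range (j + 1), ((outputs countStep (T, χ) i : ℕ) : ℤ) := fun j => by
    rw [← hTepoch, pointCount_epoch hT hχ hχt]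
  induction j with
  | zero =>
    rw [h.leftLim_cumulativeContent_of_no_arrival hτ hτt hχt hne k le_rfl (hpos 0) (fun n hn =>
      no_arrival_before_nth (p := fun n => c n ≤ k) (hmono.lt_iff_lt.1 hn.2)), hD]
    have h0 : cumulativeContent Q k 0 = 0 := Finset.sum_eq_zero fun i _ => h.start i
    have h1 : pointCount χ 0 = 0 := by
      have : {n | epoch χ n ≤ 0} = ∅ := Set.eq_empty_of_forall_notMem fun n hn =>
        absurd (epoch_pos hχ n) (not_lt.2 hn)
      rw [pointCount, this]
      simp
    rw [h0, h1, lindleyChain]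
    refine max_eq_left ?_
    have : (0 : ℤ) ≤ C * (∑ i ∈ Finset.range (0 + 1), ((outputs countStep (T, χ) i : ℕ) : ℤ) - 0) := by
      rw [sub_zero]
      exact mul_nonneg (Int.natCast_nonneg _) (Finset.sum_nonneg fun i _ => Int.natCast_nonneg _)
    linarith
  | succ j ih =>
    have hlt : cumulativeEpoch τ c k j < cumulativeEpoch τ c k (j + 1) :=
      hmono (Nat.nth_strictMono hinf (Nat.lt_succ_self j))
    have hstep := h.leftLim_cumulativeContent_of_no_arrival hτ hτt hχt hne k (hpos j).le hlt
      (fun n hn => no_arrival_between_nth (p := fun n => c n ≤ k) hinf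
        (hmono.lt_iff_lt.1 hn.1) (hmono.lt_iff_lt.1 hn.2))
    have hat : cumulativeContent Q k (cumulativeEpoch τ c k j)
        = Function.leftLim (cumulativeContent Q k) (cumulativeEpoch τ c k j) + 1 :=
      h.cumulativeContent_epoch hτ hτt hχt hne
        (Nat.nth_mem_of_infinite (p := fun n => c n ≤ k) hinf j)
    rw [hstep, hat, ih, hD, hD', Finset.sum_range_succ _ (j + 1), add_sub_cancel_left, lindleyChain]
    have : ((C * outputs countStep (T, χ) (j + 1) : ℕ) : ℤ)
        = (C : ℤ) * ((outputs countStep (T, χ) (j + 1) : ℕ) : ℤ) := by push_cast; rfl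
    rw [← this]
    omega

end Path

/-! ### The limit of the Lindley recursion -/

/-- A bounded function that vanishes at zero, tends to zero at infinity and is harmonic for the
random walk with steps `C r - 1` of weight `a r` vanishes: its maximum would propagate down to
zero. -/
lemma eq_zero_of_harmonic {a : ℕ → ℝ} (ha : ∀ r, 0 ≤ a r) (ha1 : HasSum a 1) (ha0 : 0 < a 0) (C : ℕ)
    {v : ℕ → ℝ} (hv0 : v 0 = 0) (hvnn : ∀ m, 0 ≤ v m) (hlim : Tendsto v atTop (𝓝 0))
    (hv : ∀ m, HasSum (fun r => a r * v (m + C * r)) (v (m + 1))) (m : ℕ) : v m = 0 := by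
  by_contra hm
  have hpos : 0 < v m := lt_of_le_of_ne (hvnn m) (Ne.symm hm)
  have hfin : {i | v m ≤ v i}.Finite := by
    have := hlim.eventually_lt_const hpos
    rw [← Nat.cofinite_eq_atTop, eventually_cofinite] at this
    simpa using this
  obtain ⟨i, hi, hmax⟩ := Set.exists_max_image _ v hfin ⟨m, le_refl (v m)⟩
  have hmax' : ∀ j, v j ≤ v i := fun j => by
    by_cases hj : v m ≤ v j
    · exact hmax j hj
    · exact (not_le.1 hj).le.trans hi
  have hdown : ∀ j, v (j + 1) = v i → v j = v i := fun j hj => by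
    have h1 : HasSum (fun r => a r * (v i - v (j + C * r))) 0 := by
      have := (ha1.mul_right (v i)).sub (hv j)
      rw [one_mul, hj, sub_self] at this
      simpa only [mul_sub] using this
    have h2 := le_hasSum h1 0 fun r _ => mul_nonneg (ha r) (sub_nonneg.2 (hmax' _))
    simp only [mul_zero, add_zero] at h2
    nlinarith [hmax' j]
  have hall : ∀ n j, j + n = i → v j = v i := fun n => by
    induction n with
    | zero => rintro j rfl; rfl
    | succ n ih => exact fun j hj => hdown j (ih (j + 1) (by omega))
  have := hall i 0 (by omega)
  have hi' : v m ≤ v i := hi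
  rw [hv0] at this
  linarith

/-- The tails of the Lindley recursion converge to those of the geometric distribution whose
parameter is the root of the generating function equation. -/
lemma tendsto_geometric_of_lindley {a : ℕ → ℝ} (ha : ∀ r, 0 ≤ a r) (ha1 : HasSum a 1)
    (ha0 : 0 < a 0) (C : ℕ) {ς : ℝ} (hς : ς ∈ Set.Ioo (0 : ℝ) 1)
    (hroot : HasSum (fun r => a r * ς ^ (C * r)) ς) {u : ℕ → ℕ → ℝ} (hu0 : ∀ j, u j 0 = 1)
    (hinit : ∀ m, u 0 (m + 1) = 0)
    (hstep : ∀ j m, u (j + 1) (m + 1) = ∑' r, a r * u j (m + C * r)) (m : ℕ) :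
    Tendsto (fun j => u j m) atTop (𝓝 (ς ^ m)) := by
  have hpow : ∀ m, HasSum (fun r => a r * ς ^ (m + C * r)) (ς ^ (m + 1)) := fun m => by
    have := hroot.mul_left (ς ^ m)
    rw [← pow_succ] at this
    refine this.congr_fun ?_
    intro r
    rw [pow_add]
    ring
  have hbound : ∀ j m, 0 ≤ u j m ∧ u j m ≤ ς ^ m := by
    intro j
    induction j with
    | zero =>
      intro m
      cases m with
      | zero => simp [hu0]
      | succ m => simp [hinit, pow_nonneg hς.1.le]
    | succ j ih =>
      intro m
      cases m with
      | zero => simp [hu0]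
      | succ m =>
        rw [hstep]
        refine ⟨tsum_nonneg fun r => mul_nonneg (ha r) (ih _).1, ?_⟩
        rw [← (hpow m).tsum_eq]
        refine Summable.tsum_le_tsum (fun r => mul_le_mul_of_nonneg_left (ih _).2 (ha r)) ?_
          (hpow m).summable
        exact Summable.of_nonneg_of_le (fun r => mul_nonneg (ha r) (ih _).1)
          (fun r => mul_le_mul_of_nonneg_left (ih _).2 (ha r)) (hpow m).summable
  have hle1 : ∀ j m, u j m ≤ 1 := fun j m =>
    (hbound j m).2.trans (pow_le_one₀ hς.1.le hς.2.le)
  have hsum : ∀ j m, Summable fun r => a r * u j (m + C * r) := fun j m =>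
    Summable.of_nonneg_of_le (fun r => mul_nonneg (ha r) (hbound _ _).1)
      (fun r => mul_le_mul_of_nonneg_left (hbound _ _).2 (ha r)) (hpow m).summable
  have hmono : ∀ m, Monotone fun j => u j m := by
    have : ∀ j m, u j m ≤ u (j + 1) m := by
      intro j
      induction j with
      | zero =>
        intro m
        cases m with
        | zero => simp [hu0]
        | succ m => rw [hinit]; exact (hbound _ _).1
      | succ j ih =>
        intro m
        cases m with
        | zero => simp [hu0]
        | succ m =>
          rw [hstep, hstep]
          exact Summable.tsum_le_tsum (fun r => mul_le_mul_of_nonneg_left (ih _) (ha r))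
            (hsum _ _) (hsum _ _)
    exact fun m => monotone_nat_of_le_succ fun j => this j m
  let U : ℕ → ℝ := fun m => ⨆ j, u j m
  have hU : ∀ m, Tendsto (fun j => u j m) atTop (𝓝 (U m)) := fun m =>
    tendsto_atTop_ciSup (hmono m) ⟨1, by rintro _ ⟨j, rfl⟩; exact hle1 j m⟩
  have hUle : ∀ m, U m ≤ ς ^ m := fun m => le_of_tendsto' (hU m) fun j => (hbound j m).2
  have hUnn : ∀ m, 0 ≤ U m := fun m => ge_of_tendsto' (hU m) fun j => (hbound j m).1
  have hU0 : U 0 = 1 := tendsto_nhds_unique (hU 0) (by simp [hu0])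
  have hUstep : ∀ m, U (m + 1) = ∑' r, a r * U (m + C * r) := fun m => by
    refine tendsto_nhds_unique ((tendsto_add_atTop_iff_nat 1).2 (hU (m + 1))) ?_
    simp_rw [hstep]
    refine tendsto_tsum_of_dominated_convergence (bound := a) ha1.summable
      (fun r => (hU _).const_mul _) (Eventually.of_forall fun j r => ?_)
    rw [Real.norm_of_nonneg (mul_nonneg (ha r) (hbound _ _).1)]
    exact mul_le_of_le_one_right (ha r) (hle1 _ _)
  have hUsum : ∀ m, HasSum (fun r => a r * U (m + C * r)) (U (m + 1)) := fun m => by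
    rw [hUstep]
    exact (Summable.of_nonneg_of_le (fun r => mul_nonneg (ha r) (hUnn _))
      (fun r => mul_le_mul_of_nonneg_left (hUle _) (ha r)) (hpow m).summable).hasSum
  have hpow0 : Tendsto (fun m : ℕ => ς ^ m) atTop (𝓝 0) :=
    tendsto_pow_atTop_nhds_zero_of_lt_one hς.1.le hς.2
  have hzero := eq_zero_of_harmonic ha ha1 ha0 C (v := fun m => ς ^ m - U m) (by simp [hU0])
    (fun m => sub_nonneg.2 (hUle m))
    (squeeze_zero (fun m => sub_nonneg.2 (hUle m)) (fun m => by linarith [hUnn m]) hpow0)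
    (fun m => by simpa only [mul_sub] using (hpow m).sub (hUsum m)) m
  have : U m = ς ^ m := by linarith
  rw [← this]
  exact hU m

lemma measurable_lindleyChain (C j : ℕ) : Measurable fun N : ℕ → ℕ => lindleyChain C N j := by
  induction j with
  | zero => exact measurable_const
  | succ j ih =>
    have h : Measurable fun p : ℕ × ℕ => p.1 + 1 - C * p.2 := measurable_of_countable _
    exact h.comp (ih.prodMk (measurable_pi_apply (j + 1)))

lemma lindleyChain_congr (C : ℕ) {N N' : ℕ → ℕ} (j : ℕ) (h : ∀ i < j + 1, N i = N' i) :
    lindleyChain C N j = lindleyChain C N' j := by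
  induction j with
  | zero => rfl
  | succ j ih =>
    rw [lindleyChain, lindleyChain, ih fun i hi => h i (by omega), h (j + 1) (by omega)]

/-- One step of the Lindley recursion with independent increments, in terms of tails. -/
lemma iidLaw_lindleyChain_succ (q : Measure ℕ) [IsProbabilityMeasure q] (C j m : ℕ) :
    (iidLaw q).real {N | m + 1 ≤ lindleyChain C N (j + 1)}
      = ∑' r, q.real {r} * (iidLaw q).real {N | m + C * r ≤ lindleyChain C N j} := by
  have hA : ∀ i n, MeasurableSet {N : ℕ → ℕ | n ≤ lindleyChain C N i} := fun i n =>
    measurableSet_le measurable_const (measurable_lindleyChain C i)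
  have hR : ∀ r, MeasurableSet {N : ℕ → ℕ | N 0 = r} := fun r =>
    measurableSet_eq_fun (measurable_pi_apply 0) measurable_const
  have hset : {N : ℕ → ℕ | m + 1 ≤ lindleyChain C N (j + 1)}
      = ⋃ r, {N | m + C * r ≤ lindleyChain C N j} ∩ seqDrop (j + 1) ⁻¹' {N | N 0 = r} := by
    ext N
    simp only [Set.mem_ofPred_eq, Set.mem_iUnion, Set.mem_inter_iff, Set.mem_preimage, lindleyChain,
      seqDrop, add_zero]
    constructor
    · intro h
      exact ⟨N (j + 1), by omega, rfl⟩
    · rintro ⟨r, h, rfl⟩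
      omega
  have hdisj : Pairwise (Function.onFun Disjoint fun r =>
      {N : ℕ → ℕ | m + C * r ≤ lindleyChain C N j} ∩ seqDrop (j + 1) ⁻¹' {N | N 0 = r}) := by
    intro r r' hrr
    refine Set.disjoint_left.2 fun N h h' => hrr ?_
    exact (show seqDrop (j + 1) N 0 = r from h.2).symm.trans h'.2
  have hterm : ∀ r, iidLaw q ({N : ℕ → ℕ | m + C * r ≤ lindleyChain C N j}
      ∩ seqDrop (j + 1) ⁻¹' {N | N 0 = r})
      = q {r} * iidLaw q {N | m + C * r ≤ lindleyChain C N j} := fun r => by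
    rw [iidLaw_inter_seqDrop q (j + 1) (hA _ _) (hR r), mul_comm]
    · congr 1
      have h1 : (iidLaw q).map (fun N => N 0) = q := Measure.infinitePi_map_eval (fun _ => q) 0
      conv_rhs => rw [← h1]
      rw [Measure.map_apply (measurable_pi_apply 0) (measurableSet_singleton r)]
      rfl
    · intro s s' hs h
      rw [Set.mem_ofPred_eq] at h ⊢
      rwa [← lindleyChain_congr C j hs]
  rw [measureReal_def, hset, measure_iUnion hdisj fun r => (hA _ _).inter (measurable_seqDrop _ (hR r)),
    ENNReal.tsum_toReal_eq fun r => measure_ne_top _ _]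
  simp_rw [hterm, ENNReal.toReal_mul]
  rfl

/-- If the increments are independent with law `q`, then the Lindley recursion converges in law to
the geometric distribution whose parameter is the root of the generating function equation. -/
lemma tendsto_iidLaw_lindleyChain_eq (q : Measure ℕ) [IsProbabilityMeasure q]
    (hq0 : 0 < q.real {0}) (hq1 : HasSum (fun r => q.real {r}) 1) (C : ℕ) {ς : ℝ}
    (hς : ς ∈ Set.Ioo (0 : ℝ) 1) (hroot : HasSum (fun r => q.real {r} * ς ^ (C * r)) ς) (m : ℕ) :
    Tendsto (fun j => (iidLaw q).real {N | lindleyChain C N j = m}) atTop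
      (𝓝 (ς ^ m * (1 - ς))) := by
  have htail := tendsto_geometric_of_lindley (a := fun r => q.real {r})
    (fun r => measureReal_nonneg) hq1 hq0 C hς hroot
    (u := fun j m => (iidLaw q).real {N | m ≤ lindleyChain C N j}) (fun j => by simp)
    (fun m => by simp [lindleyChain]) (fun j m => iidLaw_lindleyChain_succ q C j m)
  have hdiff : ∀ j, (iidLaw q).real {N | lindleyChain C N j = m}
      = (iidLaw q).real {N | m ≤ lindleyChain C N j}
        - (iidLaw q).real {N | m + 1 ≤ lindleyChain C N j} := fun j => by
    have hsub : {N | m + 1 ≤ lindleyChain C N j} ⊆ {N | m ≤ lindleyChain C N j} :=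
      fun N (h : m + 1 ≤ lindleyChain C N j) => Nat.le_of_succ_le h
    rw [← measureReal_sdiff hsub
      (measurableSet_le measurable_const (measurable_lindleyChain C j))]
    congr 1
    ext N
    simp only [Set.mem_ofPred_eq, Set.mem_sdiff]
    omega
  simp_rw [hdiff]
  have := (htail m).sub (htail (m + 1))
  convert! this using 2
  ring

/-! ### The generating function of the mixed Poisson law -/

lemma hasSum_poissonWeight_mul_pow (y w : ℝ) :
    HasSum (fun r => poissonWeight y r * w ^ r) (Real.exp (-(y - y * w))) := by
  have h := (NormedSpace.expSeries_div_hasSum_exp (𝔸 := ℝ) (y * w)).mul_left (Real.exp (-y))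
  rw [← Real.exp_eq_exp_ℝ, ← Real.exp_add] at h
  convert! h using 1
  · funext r
    rw [poissonWeight, mul_pow]
    ring
  · congr 1
    ring

lemma laplaceStieltjes_eq_integral {B : Measure ℝ} (hB : B (Set.Iic 0) = 0) (s : ℝ) :
    laplaceStieltjes B s = ∫ x, Real.exp (-s * x) ∂B := by
  rw [laplaceStieltjes, Measure.restrict_eq_self_of_ae_mem]
  rw [ae_iff]
  refine measure_mono_null (fun x hx => ?_) hB
  exact (not_le.1 (show ¬ 0 ≤ x from hx)).le

lemma integrable_exp_neg_mul {B : Measure ℝ} [IsProbabilityMeasure B] (hB : B (Set.Iic 0) = 0)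
    {s : ℝ} (hs : 0 ≤ s) : Integrable (fun x => Real.exp (-s * x)) B := by
  refine Integrable.mono' (integrable_const 1) (by fun_prop) ?_
  filter_upwards [ae_pos_of_measure_Iic_zero hB] with x hx
  rw [Real.norm_of_nonneg (Real.exp_pos _).le, Real.exp_le_one_iff]
  nlinarith

lemma mixedPoissonLaw_real_singleton {mu : ℝ} (hmu : 0 < mu) [IsProbabilityMeasure (expMeasure mu)]
    {B : Measure ℝ} [IsProbabilityMeasure B] (hB : B (Set.Iic 0) = 0) (r : ℕ) :
    (mixedPoissonLaw mu B).real {r} = ∫ x, poissonWeight (mu * x) r ∂B := by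
  rw [measureReal_def, mixedPoissonLaw_singleton hmu hB, integral_eq_lintegral_of_nonneg_ae]
  · filter_upwards [ae_pos_of_measure_Iic_zero hB] with x hx
    exact poissonWeight_nonneg (by positivity) r
  · exact (by fun_prop : Continuous fun x => poissonWeight (mu * x) r).aestronglyMeasurable

lemma hasSum_mixedPoissonLaw {mu : ℝ} (hmu : 0 < mu) [IsProbabilityMeasure (expMeasure mu)]
    {B : Measure ℝ} [IsProbabilityMeasure B] (hB : B (Set.Iic 0) = 0) (C : ℕ) {z : ℝ}
    (hz0 : 0 ≤ z) (hz1 : z ≤ 1) :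
    HasSum (fun r => (mixedPoissonLaw mu B).real {r} * z ^ (C * r))
      (laplaceStieltjes B (mu - mu * z ^ C)) := by
  have hs : 0 ≤ mu - mu * z ^ C := by nlinarith [pow_le_one₀ (n := C) hz0 hz1]
  have hlim : ∀ x, HasSum (fun r => poissonWeight (mu * x) r * z ^ (C * r))
      (Real.exp (-(mu - mu * z ^ C) * x)) := fun x => by
    have := hasSum_poissonWeight_mul_pow (mu * x) (z ^ C)
    simp_rw [← pow_mul] at this
    convert! this using 2
    ring
  rw [laplaceStieltjes_eq_integral hB]
  simp_rw [mixedPoissonLaw_real_singleton hmu hB, ← integral_mul_const]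
  refine hasSum_integral_of_dominated_convergence
    (fun r x => poissonWeight (mu * x) r * z ^ (C * r)) ?_ ?_ ?_ ?_ ?_
  · exact fun r => (by fun_prop : Continuous fun x => poissonWeight (mu * x) r * z ^ (C * r)
      ).aestronglyMeasurable
  · intro r
    filter_upwards [ae_pos_of_measure_Iic_zero hB] with x hx
    rw [Real.norm_of_nonneg]
    exact mul_nonneg (poissonWeight_nonneg (by positivity) r) (by positivity)
  · exact ae_of_all _ fun x => (hlim x).summable
  · simp_rw [fun x => (hlim x).tsum_eq]
    exact integrable_exp_neg_mul hB hs
  · exact ae_of_all _ hlim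

/-! ### The root of the fixed point equation -/

lemma convexOn_laplaceStieltjes {mu : ℝ} (hmu : 0 < mu) {B : Measure ℝ} [IsProbabilityMeasure B]
    (hB : B (Set.Iic 0) = 0) (C : ℕ) :
    ConvexOn ℝ (Set.Icc 0 1) fun z => laplaceStieltjes B (mu - mu * z ^ C) := by
  have hs : ∀ z ∈ Set.Icc (0 : ℝ) 1, 0 ≤ mu - mu * z ^ C := fun z hz => by
    nlinarith [pow_le_one₀ (n := C) hz.1 hz.2]
  refine ⟨convex_Icc 0 1, fun y hy z hz a b ha hb hab => ?_⟩
  simp_rw [laplaceStieltjes_eq_integral hB, smul_eq_mul]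
  have hyz := (convex_Icc (0 : ℝ) 1) hy hz ha hb hab
  rw [smul_eq_mul, smul_eq_mul] at hyz
  rw [← integral_const_mul, ← integral_const_mul, ← integral_add
    ((integrable_exp_neg_mul hB (hs y hy)).const_mul a)
    ((integrable_exp_neg_mul hB (hs z hz)).const_mul b)]
  refine integral_mono_ae (integrable_exp_neg_mul hB (hs _ hyz))
    (((integrable_exp_neg_mul hB (hs y hy)).const_mul a).add
      ((integrable_exp_neg_mul hB (hs z hz)).const_mul b)) ?_
  filter_upwards [ae_pos_of_measure_Iic_zero hB] with x hx
  have h1 : (a * y + b * z) ^ C ≤ a * y ^ C + b * z ^ C :=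
    (convexOn_pow C).2 (Set.mem_Ici.2 hy.1) (Set.mem_Ici.2 hz.1) ha hb hab
  have h2 : Real.exp (a * (-(mu - mu * y ^ C) * x) + b * (-(mu - mu * z ^ C) * x))
      ≤ a * Real.exp (-(mu - mu * y ^ C) * x) + b * Real.exp (-(mu - mu * z ^ C) * x) :=
    convexOn_exp.2 trivial trivial ha hb hab
  refine le_trans (Real.exp_le_exp.2 ?_) h2
  have h3 : mu * x * (a * y + b * z) ^ C ≤ mu * x * (a * y ^ C + b * z ^ C) :=
    mul_le_mul_of_nonneg_left h1 (by positivity)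
  have h4 : mu * x = (a + b) * (mu * x) := by rw [hab, one_mul]
  nlinarith

lemma continuousOn_laplaceStieltjes {mu : ℝ} (hmu : 0 < mu) {B : Measure ℝ}
    [IsProbabilityMeasure B] (hB : B (Set.Iic 0) = 0) (C : ℕ) :
    ContinuousOn (fun z => laplaceStieltjes B (mu - mu * z ^ C)) (Set.Icc 0 1) := by
  simp_rw [laplaceStieltjes_eq_integral hB]
  refine continuousOn_of_dominated (bound := fun _ => 1) ?_ ?_ (integrable_const 1) ?_
  · exact fun z _ => (by fun_prop : Continuous fun x => Real.exp (-(mu - mu * z ^ C) * x)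
      ).aestronglyMeasurable
  · intro z hz
    filter_upwards [ae_pos_of_measure_Iic_zero hB] with x hx
    rw [Real.norm_of_nonneg (Real.exp_pos _).le, Real.exp_le_one_iff]
    have : 0 ≤ mu - mu * z ^ C := by nlinarith [pow_le_one₀ (n := C) hz.1 hz.2]
    nlinarith
  · exact ae_of_all _ fun x => by fun_prop

/-- The difference quotients at `1` of `z ↦ exp (-(mu - mu * z ^ C) * x)`. -/
lemma tendsto_slope_exp (mu x : ℝ) (C : ℕ) {z : ℕ → ℝ} (hz : Tendsto z atTop (𝓝[≠] 1)) :
    Tendsto (fun n => (1 - Real.exp (-(mu - mu * z n ^ C) * x)) / (1 - z n)) atTop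
      (𝓝 (mu * C * x)) := by
  have h1 : HasDerivAt (fun z : ℝ => -(mu - mu * z ^ C) * x) (mu * C * x) 1 := by
    have := ((((hasDerivAt_pow C (1 : ℝ)).const_mul mu).const_sub mu).neg).mul_const x
    convert! this using 1
    simp
  have h2 := h1.exp
  simp only [one_pow, mul_one, sub_self, neg_zero, zero_mul, Real.exp_zero, one_mul] at h2
  have h3 := (hasDerivAt_iff_tendsto_slope.1 h2).comp hz
  refine h3.congr fun n => ?_
  simp only [Function.comp, slope_def_field, one_pow, mul_one, sub_self, neg_zero, zero_mul,
    Real.exp_zero]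
  rw [← neg_div_neg_eq]
  ring_nf

/-- Near `1` the transform lies below the diagonal, since its slope at `1` is the mean number of
possible departures between two arrivals. -/
lemma eventually_laplaceStieltjes_lt {mu : ℝ} (hmu : 0 < mu) {B : Measure ℝ}
    [IsProbabilityMeasure B] (hB : B (Set.Iic 0) = 0) (C : ℕ)
    (hmean : 1 < ∫⁻ x, ENNReal.ofReal (mu * C * x) ∂B) {z : ℕ → ℝ} (hz01 : ∀ n, z n ∈ Set.Ioo 0 1)
    (hz : Tendsto z atTop (𝓝 1)) :
    ∀ᶠ n in atTop, laplaceStieltjes B (mu - mu * z n ^ C) < z n := by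
  have hz' : Tendsto z atTop (𝓝[≠] 1) :=
    tendsto_nhdsWithin_iff.2 ⟨hz, Eventually.of_forall fun n => (hz01 n).2.ne⟩
  have hs : ∀ n, 0 ≤ mu - mu * z n ^ C := fun n => by
    nlinarith [pow_le_one₀ (n := C) (hz01 n).1.le (hz01 n).2.le]
  let f : ℕ → ℝ → ENNReal := fun n x =>
    ENNReal.ofReal ((1 - Real.exp (-(mu - mu * z n ^ C) * x)) / (1 - z n))
  have hf : ∀ n, Measurable (f n) := fun n => by
    refine ENNReal.measurable_ofReal.comp ?_
    fun_prop
  have hliminf : ∀ x, liminf (fun n => f n x) atTop = ENNReal.ofReal (mu * C * x) := fun x =>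
    (ENNReal.tendsto_ofReal (tendsto_slope_exp mu x C hz')).liminf_eq
  have hfatou : 1 < liminf (fun n => ∫⁻ x, f n x ∂B) atTop := by
    refine hmean.trans_le ?_
    simp_rw [← hliminf]
    exact lintegral_liminf_le hf
  filter_upwards [eventually_lt_of_lt_liminf hfatou] with n hn
  have hi := integrable_exp_neg_mul hB (hs n)
  have hpos : 0 < 1 - z n := sub_pos.2 (hz01 n).2
  have hint : Integrable (fun x => (1 - Real.exp (-(mu - mu * z n ^ C) * x)) / (1 - z n)) B :=
    ((integrable_const 1).sub hi).div_const _
  rw [← ofReal_integral_eq_lintegral_ofReal hint] at hn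
  · rw [← ENNReal.ofReal_one, ENNReal.ofReal_lt_ofReal_iff_of_nonneg zero_le_one,
      integral_div, lt_div_iff₀ hpos, integral_sub (integrable_const 1) hi] at hn
    rw [laplaceStieltjes_eq_integral hB]
    rw [integral_const, probReal_univ, one_smul] at hn
    linarith
  · filter_upwards [ae_pos_of_measure_Iic_zero hB] with x hx
    refine div_nonneg (sub_nonneg.2 (Real.exp_le_one_iff.2 ?_)) hpos.le
    nlinarith [hs n]

lemma laplaceStieltjes_zero {B : Measure ℝ} [IsProbabilityMeasure B] (hB : B (Set.Iic 0) = 0) :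
    laplaceStieltjes B 0 = 1 := by
  rw [laplaceStieltjes_eq_integral hB]
  simp

lemma laplaceStieltjes_pos {B : Measure ℝ} [IsProbabilityMeasure B] (hB : B (Set.Iic 0) = 0)
    {s : ℝ} (hs : 0 ≤ s) : 0 < laplaceStieltjes B s := by
  rw [laplaceStieltjes_eq_integral hB]
  exact integral_exp_pos (integrable_exp_neg_mul hB hs)

/-- Under the stability condition the fixed point equation has exactly one root in `(0, 1)`: the
transform is convex, positive at zero and, near `1`, below the diagonal, which it meets at `1`. -/
lemma exists_unique_root {mu : ℝ} (hmu : 0 < mu) {B : Measure ℝ} [IsProbabilityMeasure B]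
    (hB : B (Set.Iic 0) = 0) {C : ℕ} (hC : 1 ≤ C)
    (hmean : 1 < ∫⁻ x, ENNReal.ofReal (mu * C * x) ∂B) :
    ∃ ς ∈ Set.Ioo (0 : ℝ) 1, ς = laplaceStieltjes B (mu - mu * ς ^ C) ∧
      ∀ z ∈ Set.Ioo (0 : ℝ) 1, z = laplaceStieltjes B (mu - mu * z ^ C) → z = ς := by
  let z : ℕ → ℝ := fun n => 1 - 1 / ((n : ℝ) + 2)
  have hz01 : ∀ n, z n ∈ Set.Ioo (0 : ℝ) 1 := fun n => by
    have h1 : 0 < 1 / ((n : ℝ) + 2) := by positivity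
    have h2 : 1 / ((n : ℝ) + 2) < 1 := by
      rw [div_lt_one (by positivity)]
      linarith [(Nat.cast_nonneg n : (0 : ℝ) ≤ n)]
    exact ⟨by simp only [z]; linarith, by simp only [z]; linarith⟩
  have hz : Tendsto z atTop (𝓝 1) := by
    have h := ((tendsto_one_div_add_atTop_nhds_zero_nat (𝕜 := ℝ)).comp (tendsto_add_atTop_nat 1))
    have := h.const_sub 1
    rw [sub_zero] at this
    refine this.congr fun n => ?_
    simp only [Function.comp, z]
    push_cast
    ring_nf
  have hlt := eventually_laplaceStieltjes_lt hmu hB C hmean hz01 hz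
  set F : ℝ → ℝ := fun z => laplaceStieltjes B (mu - mu * z ^ C) with hF
  have hF1 : F 1 = 1 := by simp [hF, laplaceStieltjes_zero hB]
  have hF0 : 0 < F 0 := by
    refine laplaceStieltjes_pos hB ?_
    rw [zero_pow (by omega)]
    linarith
  have hconv := convexOn_laplaceStieltjes hmu hB C
  have huniq : ∀ y ∈ Set.Ioo (0 : ℝ) 1, ∀ w ∈ Set.Ioo (0 : ℝ) 1, y = F y → w = F w → ¬ y < w := by
    intro y hy w hw hyF hwF hyw
    obtain ⟨n, hn, hwn⟩ := (hlt.and (hz.eventually_const_lt hw.2)).exists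
    -- `w` lies strictly between `y` and `z n`
    have hd : 0 < z n - y := by linarith
    have hc := hconv.2 ⟨hy.1.le, hy.2.le⟩ ⟨(hz01 n).1.le, (hz01 n).2.le⟩
      (show 0 ≤ (z n - w) / (z n - y) from div_nonneg (by linarith) hd.le)
      (show 0 ≤ (w - y) / (z n - y) from div_nonneg (by linarith) hd.le)
      (by rw [← add_div, div_eq_one_iff_eq hd.ne']; ring)
    simp only [smul_eq_mul] at hc
    have e : (z n - w) / (z n - y) * y + (w - y) / (z n - y) * z n = w := by
      field_simp
      ring
    rw [e] at hc
    change F w ≤ _ * F y + _ * F (z n) at hc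
    rw [← hyF, ← hwF] at hc
    have h5 : (w - y) / (z n - y) * F (z n) < (w - y) / (z n - y) * z n :=
      mul_lt_mul_of_pos_left hn (div_pos (by linarith) hd)
    linarith
  obtain ⟨n, hn⟩ := hlt.exists
  have hcont : ContinuousOn (fun w => F w - w) (Set.Icc 0 (z n)) :=
    ((continuousOn_laplaceStieltjes hmu hB C).mono
      (Set.Icc_subset_Icc le_rfl (hz01 n).2.le)).sub continuousOn_id
  obtain ⟨ς, hς, hς0⟩ := intermediate_value_Ioo' (hz01 n).1.le hcont
    (show (0 : ℝ) ∈ Set.Ioo (F (z n) - z n) (F 0 - 0) from ⟨sub_neg.2 hn, by simpa using hF0⟩)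
  have hςF : ς = F ς := by simp only at hς0; linarith
  have hς1 : ς ∈ Set.Ioo (0 : ℝ) 1 := ⟨hς.1, hς.2.trans (hz01 n).2⟩
  refine ⟨ς, hς1, hςF, fun w hw hwF => ?_⟩
  rcases lt_trichotomy w ς with h | h | h
  · exact absurd h (huniq w hw ς hς1 hwF hςF)
  · exact h
  · exact absurd h (huniq ς hς1 w hw hςF hwF)

/-! ### The mean interarrival time and coinciding points -/

/-- Stability says that on average more than one customer can depart between two arrivals: by the
strong law of large numbers the intensity of the arrivals is the reciprocal of their mean spacing. -/
lemma one_lt_lintegral_of_stable {Ω : Type*} [MeasurableSpace Ω] {P : Measure Ω}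
    [IsProbabilityMeasure P] {C : ℕ} (hC : 1 ≤ C) {mu : ℝ} (hmu : 0 < mu) {lam : ℝ}
    {τ : ℕ → Ω → ℝ} (hτ_meas : ∀ n, Measurable (τ n)) (hτ_indep : iIndepFun τ P)
    (hτ_ident : ∀ n, IdentDistrib (τ n) (τ 0) P P) (hτ_pos : ∀ n, ∀ᵐ ω ∂P, 0 < τ n ω)
    (hlam : ∀ᵐ ω ∂P,
      Tendsto (fun t : ℝ => (pointCount (fun n => τ n ω) t : ℝ) / t) atTop (𝓝 lam))
    (hρ : lam / (mu * C) < 1) : 1 < ∫⁻ ω, ENNReal.ofReal (mu * C * τ 0 ω) ∂P := by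
  have hC' : (0 : ℝ) < C := by exact_mod_cast hC
  have hmC : 0 < mu * C := by positivity
  by_contra! hle
  -- a mean of at most `1 / (mu * C)` is finite, so the strong law applies and contradicts stability
  have hnn : 0 ≤ᵐ[P] fun ω => mu * C * τ 0 ω := by
    filter_upwards [hτ_pos 0] with ω hω
    exact (mul_pos hmC hω).le
  have hint' : Integrable (fun ω => mu * C * τ 0 ω) P := by
    refine (lintegral_ofReal_ne_top_iff_integrable
      ((hτ_meas 0).const_mul _).aestronglyMeasurable hnn).1 ?_
    exact ne_top_of_le_ne_top ENNReal.one_ne_top hle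
  have hint : Integrable (τ 0) P := by
    have := hint'.const_mul (mu * C)⁻¹
    refine this.congr (ae_of_all _ fun ω => ?_)
    field_simp
  have hmean : mu * C * ∫ ω, τ 0 ω ∂P ≤ 1 := by
    rw [← integral_const_mul]
    rw [← ofReal_integral_eq_lintegral_ofReal hint' hnn, ← ENNReal.ofReal_one] at hle
    exact (ENNReal.ofReal_le_ofReal_iff zero_le_one).1 hle
  have hslln := strong_law_ae_real τ hint (fun i j hij => hτ_indep.indepFun hij) hτ_ident
  have hepoch := ae_tendsto_epoch hτ_meas hτ_indep (fun n => (hτ_ident n).map_eq) hτ_pos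
  obtain ⟨ω, h1, h2, h3, h4⟩ := (hslln.and (hlam.and (hepoch.and (ae_all_iff.2 hτ_pos)))).exists
  have hcount : ∀ n : ℕ, pointCount (fun n => τ n ω) (epoch (fun n => τ n ω) n) = n + 1 := fun n => by
    have : {m | epoch (fun n => τ n ω) m ≤ epoch (fun n => τ n ω) n}
        = (Finset.range (n + 1) : Set ℕ) := by
      ext m
      simp [(strictMono_epoch h4).le_iff_le]
    rw [pointCount, this, Set.ncard_coe_finset, Finset.card_range]
    push_cast
    rfl
  have h5 := h2.comp h3
  have h6 := (tendsto_add_atTop_iff_nat 1).2 h1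
  have h7 := h5.mul h6
  have hone : lam * ∫ ω, τ 0 ω ∂P = 1 := by
    refine tendsto_nhds_unique h7 (tendsto_const_nhds.congr fun n => ?_)
    have hpos := epoch_pos h4 n
    simp only [Function.comp, hcount]
    change (1 : ℝ) = _ * (epoch (fun n => τ n ω) n / _)
    push_cast
    have : (n : ℝ) + 1 ≠ 0 := by positivity
    field_simp
  have hlt : lam < mu * C := by rwa [div_lt_one hmC] at hρ
  have hm0 : 0 ≤ ∫ ω, τ 0 ω ∂P := integral_nonneg_of_ae (by
    filter_upwards [hτ_pos 0] with ω hω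
    exact hω.le)
  rcases hm0.eq_or_lt with h | h
  · rw [← h, mul_zero] at hone
    exact zero_ne_one hone
  · nlinarith

lemma iidLaw_epoch_eq_zero {B : Measure ℝ} [IsProbabilityMeasure B] [NullSingletonClass B] (n : ℕ) (x : ℝ) :
    iidLaw B {s | epoch s n = x} = 0 := by
  have hm : ∀ n x, MeasurableSet {s : ℕ → ℝ | epoch s n = x} := fun n x =>
    measurableSet_eq_fun (measurable_epoch n) measurable_const
  have key : ∀ n x, iidLaw B {s | epoch s n = x}
      = ∫⁻ y, iidLaw B (seqCons y ⁻¹' {s | epoch s n = x}) ∂B := fun n x => by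
    conv_lhs => rw [← map_seqCons B]
    rw [Measure.map_apply measurable_seqCons (hm n x),
      Measure.prod_apply (measurable_seqCons (hm n x))]
    rfl
  induction n generalizing x with
  | zero =>
    rw [key, lintegral_eq_zero_iff' (by
      exact (measurable_measure_prodMk_left (measurable_seqCons (hm 0 x))).aemeasurable)]
    have : ∀ᵐ y ∂B, y ≠ x := by simp [ae_iff]
    filter_upwards [this] with y hy
    simp [epoch_seqCons_zero, hy]
  | succ n ih =>
    rw [key]
    refine (lintegral_congr fun y => ?_).trans lintegral_zero
    rw [← ih (x - y)]
    congr 1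
    ext s
    simp only [Set.mem_preimage, Set.mem_ofPred_eq, epoch_seqCons_succ]
    constructor <;> intro h <;> linarith

/-- Independent random variables do not coincide if one of them has no atoms. -/
lemma ae_ne_of_indepFun {Ω : Type*} [MeasurableSpace Ω] {P : Measure Ω} [IsProbabilityMeasure P]
    {X Y : Ω → ℝ} (hX : Measurable X) (hY : Measurable Y) (h : IndepFun X Y P)
    (hatoms : ∀ x, P.map Y {x} = 0) : ∀ᵐ ω ∂P, X ω ≠ Y ω := by
  have hd : MeasurableSet {p : ℝ × ℝ | p.1 = p.2} := measurableSet_eq_fun measurable_fst measurable_snd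
  have h1 : P.map (fun ω => (X ω, Y ω)) {p | p.1 = p.2} = 0 := by
    have : IsProbabilityMeasure (P.map Y) := Measure.isProbabilityMeasure_map hY.aemeasurable
    rw [(indepFun_iff_map_prod_eq_prod_map_map hX.aemeasurable hY.aemeasurable).1 h,
      Measure.prod_apply hd]
    refine (lintegral_congr fun x => ?_).trans lintegral_zero
    rw [← hatoms x]
    congr 1
    ext y
    simp [eq_comm]
  rw [Measure.map_apply (hX.prodMk hY) hd] at h1
  simpa [ae_iff] using h1

/-! ### The stationary distribution seen by arrivals -/

theorem mainTheorem3
    {Ω : Type*} [MeasurableSpace Ω] (P : Measure Ω) [IsProbabilityMeasure P]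
    -- number of buffers, class probabilities, depletion rate, service rate, arrival intensity
    (ℓ : ℕ) (p : Fin ℓ → ℝ) (hp : ∀ k, 0 < p k) (hp_sum : ∑ k, p k = 1)
    (C : ℕ) (hC : 1 ≤ C) (mu : ℝ) (hmu : 0 < mu) (lam : ℝ)
    -- the arrivals form a renewal process of intensity `lam`
    (τ : ℕ → Ω → ℝ) (hτ_meas : ∀ n, Measurable (τ n)) (hτ_indep : iIndepFun τ P)
    (hτ_ident : ∀ n, IdentDistrib (τ n) (τ 0) P P) (hτ_pos : ∀ n, ∀ᵐ ω ∂P, 0 < τ n ω)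
    (hlam : ∀ᵐ ω ∂P,
      Tendsto (fun t : ℝ => (pointCount (fun n => τ n ω) t : ℝ) / t) atTop (𝓝 lam))
    -- the classes of the customers are independent with law `p`
    (c : ℕ → Ω → Fin ℓ) (hc_meas : ∀ n, Measurable (c n)) (hc_indep : iIndepFun c P)
    (hc_law : ∀ n k, P.real {ω | c n ω = k} = p k)
    -- the departure epochs form a Poisson process of rate `mu`
    (χ : ℕ → Ω → ℝ) (hχ_meas : ∀ n, Measurable (χ n)) (hχ_indep : iIndepFun χ P)
    (hχ_law : ∀ n, P.map (χ n) = expMeasure mu)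
    -- arrival times, classes and departure epochs are mutually independent
    (hτc : IndepFun (fun ω n => τ n ω) (fun ω n => c n ω) P)
    (hτcχ : IndepFun (fun ω => ((fun n => τ n ω), (fun n => c n ω))) (fun ω n => χ n ω) P)
    -- stability
    (hρ : lam / (mu * C) < 1)
    -- the buffer contents
    (Q : Fin ℓ → ℝ → Ω → ℤ)
    (hQ : ∀ᵐ ω ∂P, IsBufferContent (classCount (fun n => τ n ω) (fun n => c n ω))
      (departureProcess C (fun n => χ n ω)) (fun k t => Q k t ω))
    (k : Fin ℓ) :
    ∃ ς : ℝ,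
      ς ∈ Set.Ioo (0 : ℝ) 1 ∧
      ς = laplaceStieltjes (interarrivalLaw P τ c k) (mu - mu * ς ^ C) ∧
      (∀ z ∈ Set.Ioo (0 : ℝ) 1,
        z = laplaceStieltjes (interarrivalLaw P τ c k) (mu - mu * z ^ C) → z = ς) ∧
      ∀ m : ℕ, Tendsto
        (fun j : ℕ => P.real {ω |
          Function.leftLim (cumulativeContent (fun i t => Q i t ω) k)
            (cumulativeEpoch (fun n => τ n ω) (fun n => c n ω) k j) = (m : ℤ)})
        atTop (𝓝 (ς ^ m * (1 - ς))) := by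
  have hprobE : IsProbabilityMeasure (expMeasure mu) := isProbabilityMeasure_expMeasure hmu
  set F := P.map (τ 0) with hF
  set κ := P.map (c 0) with hκ
  have hprobF : IsProbabilityMeasure F := Measure.isProbabilityMeasure_map (hτ_meas 0).aemeasurable
  have hprobκ : IsProbabilityMeasure κ := Measure.isProbabilityMeasure_map (hc_meas 0).aemeasurable
  have hcsing : ∀ n i, P.map (c n) {i} = ENNReal.ofReal (p i) := fun n i => by
    rw [Measure.map_apply (hc_meas n) (measurableSet_singleton i), ← hc_law n i, ofReal_measureReal]
    rfl
  have hc_map : ∀ n, P.map (c n) = κ := fun n =>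
    Measure.ext_iff_singleton.2 fun i => by rw [hκ, hcsing, hcsing]
  have hτ_map : ∀ n, P.map (τ n) = F := fun n => (hτ_ident n).map_eq
  have hτm : Measurable fun ω n => τ n ω := measurable_pi_iff.2 hτ_meas
  have hcm : Measurable fun ω n => c n ω := measurable_pi_iff.2 hc_meas
  have hχm : Measurable fun ω n => χ n ω := measurable_pi_iff.2 hχ_meas
  -- the marked sequence of the arrivals
  let zip : (ℕ → ℝ) × (ℕ → Fin ℓ) → ℕ → ℝ × Fin ℓ := fun e n => (e.1 n, e.2 n)
  have hzip : Measurable zip := by fun_prop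
  have hpairs : P.map (fun ω => zip ((fun n => τ n ω), (fun n => c n ω))) = iidLaw (F.prod κ) := by
    rw [← map_pairs_iidLaw F κ, ← iIndepFun.map_eq_iidLaw hτ_meas hτ_indep hτ_map,
      ← iIndepFun.map_eq_iidLaw hc_meas hc_indep hc_map,
      ← (indepFun_iff_map_prod_eq_prod_map_map hτm.aemeasurable hcm.aemeasurable).1 hτc,
      Measure.map_map hzip (hτm.prodMk hcm)]
    rfl
  let H : Set (ℝ × Fin ℓ) := {x | x.2 ≤ k}
  have hH : MeasurableSet H := measurableSet_le measurable_snd measurable_const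
  have hHpos : F.prod κ H ≠ 0 := by
    have h1 : (Set.univ : Set ℝ) ×ˢ {k} ⊆ H := fun x hx => (show x.2 = k from hx.2).le
    refine (lt_of_lt_of_le ?_ (measure_mono h1)).ne'
    rw [Measure.prod_prod, measure_univ, one_mul, hκ, hcsing]
    exact ENNReal.ofReal_pos.2 (hp k)
  -- the thinned renewal process
  have hbm : Measurable (blockStep (Prod.fst : ℝ × Fin ℓ → ℝ) H) :=
    measurable_blockStep measurable_fst hH
  have hbm1 : Measurable fun s => (blockStep (Prod.fst : ℝ × Fin ℓ → ℝ) H s).1 :=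
    measurable_fst.comp hbm
  set B := interarrivalLaw P τ c k with hBdef
  have hfirst : ∀ ω, cumulativeEpoch (fun n => τ n ω) (fun n => c n ω) k 0
      = (blockStep Prod.fst H (zip ((fun n => τ n ω), (fun n => c n ω)))).1 := fun ω => by
    have := nth_firstHit_zero H (zip ((fun n => τ n ω), (fun n => c n ω)))
    rw [blockStep, ← this]
    rfl
  have hzm : Measurable fun ω => zip ((fun n => τ n ω), (fun n => c n ω)) :=
    hzip.comp (hτm.prodMk hcm)
  have hBm : Measurable fun ω => cumulativeEpoch (fun n => τ n ω) (fun n => c n ω) k 0 := by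
    simp_rw [hfirst]
    exact hbm1.comp hzm
  have hB : B = (iidLaw (F.prod κ)).map fun s => (blockStep Prod.fst H s).1 := by
    rw [hBdef, interarrivalLaw, ← hpairs, Measure.map_map hbm1 hzm]
    simp_rw [hfirst]
    rfl
  have hprobB : IsProbabilityMeasure B := Measure.isProbabilityMeasure_map hBm.aemeasurable
  have hblock : (iidLaw (F.prod κ)).map (blockStep Prod.fst H) = B.prod (iidLaw (F.prod κ)) := by
    rw [hB]
    exact map_blockStep measurable_fst hH hHpos
  -- properties that hold almost surely
  have hτpos' := ae_all_iff.2 hτ_pos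
  have hχ0 : ∀ n, ∀ᵐ ω ∂P, 0 < χ n ω := fun n => by
    have := ae_pos_of_measure_Iic_zero (expMeasure_Iic_zero hmu)
    rw [← hχ_law n] at this
    exact ae_of_ae_map (hχ_meas n).aemeasurable this
  have hχpos' := ae_all_iff.2 hχ0
  have hτt := ae_tendsto_epoch hτ_meas hτ_indep hτ_map hτ_pos
  have hχt := ae_tendsto_epoch hχ_meas hχ_indep hχ_law hχ0
  have hfreq : ∀ᵐ ω ∂P, ∃ᶠ n in atTop, c n ω ≤ k := by
    refine ae_frequently_mem hc_meas hc_indep hc_map (A := {i | i ≤ k})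
      (Set.toFinite _).measurableSet ?_
    refine (lt_of_lt_of_le ?_ (measure_mono (show {k} ⊆ {i | i ≤ k} from fun i hi => le_of_eq hi))).ne'
    rw [hκ, hcsing]
    exact ENNReal.ofReal_pos.2 (hp k)
  have hχlaw : P.map (fun ω n => χ n ω) = iidLaw (expMeasure mu) :=
    iIndepFun.map_eq_iidLaw hχ_meas hχ_indep hχ_law
  have hne : ∀ᵐ ω ∂P, ∀ n m, epoch (fun n => τ n ω) n ≠ epoch (fun n => χ n ω) m := by
    have hatoms : NullSingletonClass (expMeasure mu) := by
      refine ⟨fun x => ?_⟩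
      have : expMeasure mu = volume.withDensity (exponentialPDF mu) := rfl
      rw [this]
      exact withDensity_absolutelyContinuous _ _ Real.volume_singleton
    refine ae_all_iff.2 fun n => ae_all_iff.2 fun m => ?_
    refine ae_ne_of_indepFun ((measurable_epoch n).comp hτm) ((measurable_epoch m).comp hχm)
      (hτcχ.comp ((measurable_epoch n).comp measurable_fst) (measurable_epoch m)) fun x => ?_
    have h1 : P.map (fun ω => epoch (fun n => χ n ω) m) {x}
        = iidLaw (expMeasure mu) {s | epoch s m = x} := by
      have hem : Measurable fun ω => epoch (fun n => χ n ω) m := (measurable_epoch m).comp hχm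
      rw [← hχlaw, Measure.map_apply hem (measurableSet_singleton x),
        Measure.map_apply hχm (measurableSet_eq_fun (measurable_epoch m) measurable_const)]
      rfl
    exact h1.trans (iidLaw_epoch_eq_zero m x)
  have hB0 : B (Set.Iic 0) = 0 := by
    rw [hBdef, interarrivalLaw, Measure.map_apply hBm measurableSet_Iic]
    refine measure_eq_zero_iff_ae_notMem.2 ?_
    filter_upwards [hτpos'] with ω hω h
    exact absurd (epoch_pos hω _) (not_lt.2 h)
  have hmean : 1 < ∫⁻ x, ENNReal.ofReal (mu * C * x) ∂B := by
    refine (one_lt_lintegral_of_stable hC hmu hτ_meas hτ_indep hτ_ident hτ_pos hlam hρ).trans_le ?_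
    rw [hBdef, interarrivalLaw, lintegral_map (by fun_prop) hBm]
    refine lintegral_mono_ae ?_
    filter_upwards [hτpos'] with ω hω
    refine ENNReal.ofReal_le_ofReal (mul_le_mul_of_nonneg_left ?_ (by positivity))
    have := (strictMono_epoch hω).monotone
      (Nat.zero_le (Nat.nth (fun n => c n ω ≤ k) 0))
    simpa [epoch, cumulativeEpoch] using this
  obtain ⟨ς, hς, hroot, huniq⟩ := exists_unique_root hmu hB0 hC hmean
  refine ⟨ς, hς, hroot, huniq, fun m => ?_⟩
  -- the numbers of possible departures between the arrivals are independent
  set q := mixedPoissonLaw mu B with hq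
  have hprobq : IsProbabilityMeasure q :=
    Measure.isProbabilityMeasure_map measurable_countTo.aemeasurable
  let T : Ω → ℕ → ℝ := fun ω =>
    outputs (blockStep Prod.fst H) (zip ((fun n => τ n ω), (fun n => c n ω)))
  have hom := measurable_outputs hbm
  have hTm : Measurable T := hom.comp hzm
  have hTlaw : P.map T = iidLaw B := by
    rw [← map_outputs hbm hblock, ← hpairs, Measure.map_map hom hzm]
    rfl
  have hTχ : P.map (fun ω => (T ω, fun n => χ n ω)) = (iidLaw B).prod (iidLaw (expMeasure mu)) := by
    have hind : IndepFun T (fun ω n => χ n ω) P := hτcχ.comp (hom.comp hzip) measurable_id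
    rw [(indepFun_iff_map_prod_eq_prod_map_map hTm.aemeasurable hχm.aemeasurable).1 hind, hTlaw,
      hχlaw]
  have hNm := measurable_outputs measurable_countStep
  have hN : P.map (fun ω => outputs countStep (T ω, fun n => χ n ω)) = iidLaw q := by
    rw [← map_outputs measurable_countStep (map_countStep hmu hB0), ← hTχ,
      Measure.map_map hNm (hTm.prodMk hχm)]
    rfl
  have hTpos : ∀ᵐ ω ∂P, ∀ n, 0 < T ω n := by
    have := ae_iidLaw_pos hB0
    rw [← hTlaw] at this
    exact ae_of_ae_map hTm.aemeasurable this
  have hevent : ∀ j : ℕ, P.real {ω | Function.leftLim (cumulativeContent (fun i t => Q i t ω) k)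
      (cumulativeEpoch (fun n => τ n ω) (fun n => c n ω) k j) = (m : ℤ)}
      = (iidLaw q).real {N | lindleyChain C N j = m} := fun j => by
    have hms : MeasurableSet {N : ℕ → ℕ | lindleyChain C N j = m} :=
      measurableSet_eq_fun (measurable_lindleyChain C j) measurable_const
    have hcomp : Measurable fun ω => outputs countStep (T ω, fun n => χ n ω) :=
      hNm.comp (hTm.prodMk hχm)
    rw [← hN, map_measureReal_apply hcomp hms]
    refine measureReal_congr ?_
    filter_upwards [hQ, hτpos', hτt, hχpos', hχt, hne, hfreq, hTpos] with ω h1 h2 h3 h4 h5 h6 h7 h8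
    refine propext ?_
    change Function.leftLim (cumulativeContent (fun i t => Q i t ω) k)
      (cumulativeEpoch (fun n => τ n ω) (fun n => c n ω) k j) = (m : ℤ)
      ↔ lindleyChain C (outputs countStep (T ω, fun n => χ n ω)) j = m
    rw [h1.leftLim_cumulativeContent_eq_lindleyChain h2 h3 h4 h5 h6 h7 h8
      (fun j => epoch_outputs_blockStep (w := Prod.fst) (H := H)
        (s := zip ((fun n => τ n ω), (fun n => c n ω))) h7 j) j]
    exact Nat.cast_inj
  simp_rw [hevent]
  have hsum1 := hasSum_mixedPoissonLaw hmu hB0 C zero_le_one le_rfl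
  simp only [one_pow, mul_one, sub_self, laplaceStieltjes_zero hB0] at hsum1
  have hsumς := hasSum_mixedPoissonLaw hmu hB0 C hς.1.le hς.2.le
  rw [← hroot] at hsumς
  refine tendsto_iidLaw_lindleyChain_eq q ?_ hsum1 C hς hsumς m
  -- the probability of no departure is the transform at `mu`
  have h0 : q.real {0} = laplaceStieltjes B mu := by
    rw [hq, mixedPoissonLaw_real_singleton hmu hB0, laplaceStieltjes_eq_integral hB0]
    simp [poissonWeight]
  rw [h0]
  exact laplaceStieltjes_pos hB0 hmu.le
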